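/- Let $\mathbb K$ be an algebraically closed field and let $q\in\mathbb K$ be nonzero and not a root of $1$. Put $[3]_q=(q^3-q^{-3})/(q-q^{-1})$. Let $\mathcal A_q$ be the unital associative $\mathbb K$-algebra with generators $x,y$ (the standard generators) and relations $$x^3y-[3]_qx^2yx+[3]_qxyx^2-yx^3=0,\qquad y^3x-[3]_qy^2xy+[3]_qyxy^2-xy^3=0.$$ Let $\boxtimes_q$ be the unital associative $\mathbb K$-algebra with generators $x_{ij}$ ($i,j\in\mathbb Z/4\mathbb Z$, $j-i=1$ or $j-i=2$) and relations: (i) $x_{ij}x_{ji}=1$ if $j-i=2$; (ii) $\dfrac{q\,x_{hi}x_{ij}-q^{-1}x_{ij}x_{hi}}{q-q^{-1}}=1$ if $(i-h,j-i)$ is one of $(1,1),(1,2),(2,1)$; (iii) $x_{hi}^3x_{jk}-[3]_qx_{hi}^2x_{jk}x_{hi}+[3]_qx_{hi}x_{jk}x_{hi}^2-x_{jk}x_{hi}^3=0$ if $i-h=j-i=k-j=1$. A finite-dimensional irreducible $\mathcal A_q$-module $V$ is NonNil if neither $x$ nor $y$ is nilpotent on $V$. It has type $(\alpha,\alpha^*)$,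 where $\alpha,\alpha^*\in\mathbb K$ are nonzero, if there is an integer $d\ge 0$ such that the set of eigenvalues of $x$ on $V$ is $\{\alpha q^{d-2n}\mid 0\le n\le d\}$ and that of $y$ is $\{\alpha^*q^{d-2n}\mid 0\le n\le d\}$. A finite-dimensional irreducible $\boxtimes_q$-module $V$ has type $\varepsilon\in\{1,-1\}$ if there is an integer $d\ge 0$ such that every generator $x_{ij}$ is semisimple on $V$ with set of eigenvalues $\{\varepsilon q^{d-2n}\mid 0\le n\le d\}$. **Theorem.** (a) Let $V$ be a NonNil finite-dimensional irreducible $\mathcal A_q$-module of type $(1,1)$. Then there exists a unique $\boxtimes_q$-module structure on the $\mathbb K$-vector space $V$ such that $x$ and $y$ act on $V$ as $x_{01}$ and $x_{23}$, respectively. This $\boxtimes_q$-module structure is irreducible and of type $1$. (b) There is a $\mathbb K$-algebra homomorphism $\mathcal A_q\to\boxtimes_q$ with $x\mapsto x_{01}$, $y\mapsto x_{23}$, and restriction of modules along it induces a bijection from the set of isomorphism classes of finite-dimensional irreducible $\boxtimes_q$-modules of type $1$ onto the set of isomorphism classes of NonNil finite-dimensional irreducible $\mathcal A_q$-modules of type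 $(1,1)$. -/

import Mathlib

open CategoryTheory
open scoped ModuleCat

universe u v

noncomputable section

/-- The `q`-integer `[n]_q = (q^n - q^{-n}) / (q - q^{-1})`. -/
def qInt {K : Type u} [Field K] (q : K) (n : ℕ) : K :=
  (q ^ n - (q⁻¹) ^ n) / (q - q⁻¹)

/-- The cubic `q`-Serre expression `x³y - [3]_q x²yx + [3]_q xyx² - yx³`. -/
def qSerre {K : Type u} [Field K] (q : K) {A : Type*} [Ring A] [Algebra K A] (x y : A) : A :=
  x ^ 3 * y - qInt q 3 • (x ^ 2 * y * x) + qInt q 3 • (x * y * x ^ 2) - y * x ^ 3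

/-! ### The algebra `A_q` -/

/-- The two generators of `A_q`. -/
inductive AqGen : Type
  | x
  | y

/-- The defining relations of `A_q`: the two cubic `q`-Serre relations. -/
inductive AqRel {K : Type u} [Field K] (q : K) :
    FreeAlgebra K AqGen → FreeAlgebra K AqGen → Prop
  | serre_xy : AqRel q (qSerre q (FreeAlgebra.ι K AqGen.x) (FreeAlgebra.ι K AqGen.y)) 0
  | serre_yx : AqRel q (qSerre q (FreeAlgebra.ι K AqGen.y) (FreeAlgebra.ι K AqGen.x)) 0

/-- The unital associative `K`-algebra `A_q` with generators `x, y` and relations `AqRel`. -/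
abbrev Aq {K : Type u} [Field K] (q : K) : Type u := RingQuot (AqRel q)

/-- The standard generators `x, y` of `A_q`. -/
def Aq.gen {K : Type u} [Field K] (q : K) (g : AqGen) : Aq q :=
  RingQuot.mkAlgHom K (AqRel q) (FreeAlgebra.ι K g)

/-! ### The `q`-tetrahedron algebra -/

/-- The index pairs `(i, j)` in `ℤ/4ℤ` with `j - i = 1` or `j - i = 2`. -/
abbrev TetEdge (i j : ZMod 4) : Prop := j - i = 1 ∨ j - i = 2

/-- The eight generators `x_{ij}`. -/
abbrev TetGen : Type := {p : ZMod 4 × ZMod 4 // TetEdge p.1 p.2}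

/-- The generator `x_{ij}` in the free algebra. -/
def freeTet (K : Type u) [Field K] (i j : ZMod 4) (h : TetEdge i j) : FreeAlgebra K TetGen :=
  FreeAlgebra.ι K ⟨(i, j), h⟩

/-- The defining relations of the `q`-tetrahedron algebra. The `TetEdge` arguments hold
automatically for the indices that occur; they are there to name the generators. -/
inductive TetRel {K : Type u} [Field K] (q : K) :
    FreeAlgebra K TetGen → FreeAlgebra K TetGen → Prop
  | inv (i j : ZMod 4) (hij : TetEdge i j) (hji : TetEdge j i) (h2 : j - i = 2) :
      TetRel q (freeTet K i j hij * freeTet K j i hji) 1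
  | weyl (h i j : ZMod 4) (hhi : TetEdge h i) (hij : TetEdge i j)
      (hcase : (i - h, j - i) = (1, 1) ∨ (i - h, j - i) = (1, 2) ∨ (i - h, j - i) = (2, 1)) :
      TetRel q
        ((q - q⁻¹)⁻¹ • (q • (freeTet K h i hhi * freeTet K i j hij)
          - q⁻¹ • (freeTet K i j hij * freeTet K h i hhi))) 1
  | serre (h i j k : ZMod 4) (hhi : TetEdge h i) (hjk : TetEdge j k)
      (h1 : i - h = 1) (h2 : j - i = 1) (h3 : k - j = 1) :
      TetRel q (qSerre q (freeTet K h i hhi) (freeTet K j k hjk)) 0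

/-- The `q`-tetrahedron algebra `⊠_q`, a unital associative `K`-algebra. -/
abbrev Tet {K : Type u} [Field K] (q : K) : Type u := RingQuot (TetRel q)

/-- The generator `x_{ij}` of `⊠_q`. -/
def Tet.gen {K : Type u} [Field K] (q : K) (i j : ZMod 4)
    (h : TetEdge i j := by decide) : Tet q :=
  RingQuot.mkAlgHom K (TetRel q) (freeTet K i j h)

/-! ### NonNil modules and types -/

section Modules

variable {K : Type u} [Field K] (q : K) (V : Type v) [AddCommGroup V] [Module K V]

/-- Neither standard generator of `A_q` is nilpotent on `V`. -/
def Aq.NonNil [Module (Aq q) V] [IsScalarTower K (Aq q) V] : Prop :=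
  ∀ g : AqGen, ¬ IsNilpotent (Algebra.lsmul K K V (Aq.gen q g))

/-- The `A_q`-module `V` has type `(α, β)`: for some `d ≥ 0` the sets of distinct eigenvalues
of `x` and of `y` on `V` are `{α q^{d-2n} | 0 ≤ n ≤ d}` and `{β q^{d-2n} | 0 ≤ n ≤ d}`. -/
def Aq.HasType [Module (Aq q) V] [IsScalarTower K (Aq q) V] (α β : K) : Prop :=
  α ≠ 0 ∧ β ≠ 0 ∧ ∃ d : ℕ,
    {θ : K | Module.End.HasEigenvalue (Algebra.lsmul K K V (Aq.gen q AqGen.x)) θ} =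
      {θ : K | ∃ n : ℕ, n ≤ d ∧ θ = α * q ^ ((d : ℤ) - 2 * (n : ℤ))} ∧
    {θ : K | Module.End.HasEigenvalue (Algebra.lsmul K K V (Aq.gen q AqGen.y)) θ} =
      {θ : K | ∃ n : ℕ, n ≤ d ∧ θ = β * q ^ ((d : ℤ) - 2 * (n : ℤ))}

/-- The `⊠_q`-module `V` has type `ε ∈ {1, -1}`: for some `d ≥ 0` each generator `x_{ij}` is
semisimple on `V` with set of distinct eigenvalues `{ε q^{d-2n} | 0 ≤ n ≤ d}`. -/
def Tet.HasType [Module (Tet q) V] [IsScalarTower K (Tet q) V] (ε : K) : Prop :=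
  (ε = 1 ∨ ε = -1) ∧ ∃ d : ℕ, ∀ (i j : ZMod 4) (h : TetEdge i j),
    (Algebra.lsmul K K V (Tet.gen q i j h) : Module.End K V).IsSemisimple ∧
    {θ : K | Module.End.HasEigenvalue (Algebra.lsmul K K V (Tet.gen q i j h)) θ} =
      {θ : K | ∃ n : ℕ, n ≤ d ∧ θ = ε * q ^ ((d : ℤ) - 2 * (n : ℤ))}

end Modules

/-! ### Isomorphism classes and restriction along `A_q → ⊠_q` -/

section IsoClasses

variable {K : Type u} [Field K] (q : K)

theorem map_qSerre {A B : Type*} [Ring A] [Algebra K A] [Ring B] [Algebra K B]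
    (f : A →ₐ[K] B) (x y : A) : f (qSerre q x y) = qSerre q (f x) (f y) := by
  simp [qSerre]

theorem Tet.qSerre_gen (h i j k : ZMod 4) (hhi : TetEdge h i) (hjk : TetEdge j k)
    (h1 : i - h = 1) (h2 : j - i = 1) (h3 : k - j = 1) :
    qSerre q (Tet.gen q h i hhi) (Tet.gen q j k hjk) = 0 := by
  have := RingQuot.mkAlgHom_rel K (TetRel.serre (q := q) h i j k hhi hjk h1 h2 h3)
  rw [map_qSerre, map_zero] at this
  exact this

/-- The images of the standard generators: `x ↦ x_{01}`, `y ↦ x_{23}`. -/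
def AqGen.toTet : AqGen → Tet q
  | AqGen.x => Tet.gen q 0 1
  | AqGen.y => Tet.gen q 2 3

/-- The algebra homomorphism `A_q → ⊠_q` that sends `x ↦ x_{01}`, `y ↦ x_{23}`. -/
def Aq.toTet : Aq q →ₐ[K] Tet q :=
  RingQuot.liftAlgHom K ⟨FreeAlgebra.lift K (AqGen.toTet q), by
    rintro _ _ (_ | _)
    · rw [map_qSerre, map_zero, FreeAlgebra.lift_ι_apply, FreeAlgebra.lift_ι_apply]
      exact Tet.qSerre_gen q 0 1 2 3 _ _ (by decide) (by decide) (by decide)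
    · rw [map_qSerre, map_zero, FreeAlgebra.lift_ι_apply, FreeAlgebra.lift_ι_apply]
      exact Tet.qSerre_gen q 2 3 0 1 _ _ (by decide) (by decide) (by decide)⟩

/-- Isomorphism classes of modules over the ring `R`. -/
abbrev ModIsoClass (R : Type u) [Ring R] : Type (max u (v + 1)) :=
  Quotient (isIsomorphicSetoid (ModuleCat.{v} R))

/-- The isomorphism class of a module. -/
def ModIsoClass.mk {R : Type u} [Ring R] (M : ModuleCat.{v} R) : ModIsoClass.{u, v} R :=
  Quotient.mk (isIsomorphicSetoid (ModuleCat.{v} R)) M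

/-- The isomorphism classes of finite-dimensional irreducible `⊠_q`-modules of type `1`. -/
def Tet.typeOneClasses : Set (ModIsoClass.{u, v} (Tet q)) :=
  {c | ∃ M : ModuleCat.{v} (Tet q), ModIsoClass.mk M = c ∧
    Module.Finite K M ∧ IsSimpleModule (Tet q) M ∧ Tet.HasType q M 1}

/-- The isomorphism classes of NonNil finite-dimensional irreducible `A_q`-modules of
type `(1,1)`. -/
def Aq.typeOneClasses : Set (ModIsoClass.{u, v} (Aq q)) :=
  {c | ∃ M : ModuleCat.{v} (Aq q), ModIsoClass.mk M = c ∧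
    Module.Finite K M ∧ IsSimpleModule (Aq q) M ∧ Aq.NonNil q M ∧ Aq.HasType q M 1 1}

/-- The map on isomorphism classes that sends the class of a `⊠_q`-module to the class of the
same vector space with `x, y` acting as `x_{01}, x_{23}`. -/
def Tet.restrictClass : ModIsoClass.{u, v} (Tet q) → ModIsoClass.{u, v} (Aq q) :=
  Quotient.map (sa := isIsomorphicSetoid (ModuleCat.{v} (Tet q)))
    (sb := isIsomorphicSetoid (ModuleCat.{v} (Aq q)))
    (ModuleCat.restrictScalars.{v} (Aq.toTet q).toRingHom).obj
    (fun _ _ ⟨e⟩ => ⟨(ModuleCat.restrictScalars.{v} (Aq.toTet q).toRingHom).mapIso e⟩)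

end IsoClasses

end

/-! ### Flags and operators acting on them -/

section Flags

variable {K : Type u} [Field K] {V : Type v} [AddCommGroup V] [Module K V]

/-! The proof is linear algebra of flags. On an irreducible `A_q`-module of type (1,1), the q-Serre
relation says that `Y` sends an eigenvector of `X` into a sum of three neighbouring eigenspaces. The
span of the eigenspaces is therefore invariant, so `X` is diagonalizable, and likewise `Y`. The
eigenspaces of `X`, listed in either of the two orders, give two flags, and those of `Y` give two
more: one for each vertex of a tetrahedron (`tetFlag`). Any two of them are opposite
(`IsSerrePair.tetFlag_opposite`). For a flag `F` of `X` and a flag `G` of `Y` the sum of the `F t ⊓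
G (s - t)` over `t` is stable under `X` and `Y`, hence zero or everything; it is zero for `s = d -
1` and everything for `s = d`.

Opposite flags `F`, `G` decompose the space into the pieces `F t ⊓ G (d - t)`. The generator
`x_{ij}` is the operator with scalar `q ^ (d - 2t)` on the pieces of flags `i` and `j`; it is the
only operator with the prescribed scalars on the factors of both flags. The defining relations
follow from how the operators shift the flags (`IsSerrePair.exists_tetRelations`). Conversely, the
relations force every solution to act on the flags in this way (`TetRelations.actsOn`), which yields
uniqueness, semisimplicity and the spectrum.

For the bijection it remains to see that an irreducible `⊠_q`-module of type 1 stays irreducible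
under `x₀₁` and `x₂₃` alone. A minimal nonzero subspace `W` invariant under both meets all four
flags for the first time at the same index. Hence `W` is spanned by its intersections with the
pieces, and is stable under every `x_{ij}` (`TetRelations.invariant_of_minimal`). Injectivity on
classes is then uniqueness of the action, and surjectivity is its existence.

The flag lemmas carry a parameter `p`, used with both `q` and `q⁻¹`, because reversing the order of
the eigenspaces inverts it. Integer indices make `t - 1` and `d - t` meaningful without truncation.
-/

/-- `q` is nonzero and not a root of unity. -/
structure IsGeneric (q : K) : Prop where
  ne_zero : q ≠ 0
  pow_ne_one : ∀ n : ℕ, 0 < n → q ^ n ≠ 1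

namespace IsGeneric

variable {q : K}

theorem inv (hq : IsGeneric q) : IsGeneric q⁻¹ where
  ne_zero := inv_ne_zero hq.ne_zero
  pow_ne_one n hn h := hq.pow_ne_one n hn (by simpa [inv_pow] using h)

theorem zpow_ne_one (hq : IsGeneric q) {n : ℤ} (hn : n ≠ 0) : q ^ n ≠ 1 := by
  intro h
  refine hq.pow_ne_one n.natAbs (Int.natAbs_pos.2 hn) ?_
  rw [← zpow_natCast]
  rcases Int.natAbs_eq n with h' | h'
  · rwa [← h']
  · rw [h', zpow_neg, inv_eq_one] at h
    exact h

theorem zpow_inj (hq : IsGeneric q) {m n : ℤ} (h : q ^ m = q ^ n) : m = n := by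
  by_contra hmn
  refine hq.zpow_ne_one (sub_ne_zero.2 hmn) ?_
  rw [zpow_sub₀ hq.ne_zero, h, div_self (zpow_ne_zero _ hq.ne_zero)]

theorem sub_inv_ne_zero (hq : IsGeneric q) : q - q⁻¹ ≠ 0 := by
  intro h
  have := hq.zpow_inj (m := 1) (n := -1) (by simpa [sub_eq_zero] using h)
  omega

theorem qInt_three (hq : IsGeneric q) : qInt q 3 = q ^ 2 + 1 + q⁻¹ ^ 2 := by
  have h0 := hq.ne_zero
  have h := hq.sub_inv_ne_zero
  rw [qInt, div_eq_iff h]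
  field_simp
  ring

end IsGeneric

/-- An increasing family of subspaces from `⊥` (below `0`) to `⊤` (from `d` on). -/
structure IsFlag (d : ℕ) (F : ℤ → Submodule K V) : Prop where
  mono : Monotone F
  bot : ∀ k, k < 0 → F k = ⊥
  top : ∀ k, (d : ℤ) ≤ k → F k = ⊤

/-- `E` preserves the family `F`, with eigenvalue `p ^ (d - 2n)` on the `n`-th factor. -/
def ActsOn (p : K) (d : ℕ) (E : Module.End K V) (F : ℤ → Submodule K V) : Prop :=
  ∀ n : ℤ, ∀ v ∈ F n, E v - p ^ ((d : ℤ) - 2 * n) • v ∈ F (n - 1)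

/-- `E` moves each member of the family `F` into the next one. -/
def Raises (E : Module.End K V) (F : ℤ → Submodule K V) : Prop :=
  ∀ n : ℤ, ∀ v ∈ F n, E v ∈ F (n + 1)

/-- Two flags in opposite position. -/
structure OppositeFlags (d : ℕ) (F G : ℤ → Submodule K V) : Prop where
  left : IsFlag d F
  right : IsFlag d G
  disj : ∀ t : ℤ, F t ⊓ G (d - 1 - t) = ⊥
  sup : ⨆ t : ℤ, F t ⊓ G (d - t) = ⊤

theorem IsFlag.mem_of_le {d : ℕ} {F : ℤ → Submodule K V} (hF : IsFlag d F) {m n : ℤ}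
    (h : m ≤ n) {v : V} (hv : v ∈ F m) : v ∈ F n := hF.mono h hv

theorem ActsOn.mem {p : K} {d : ℕ} {E : Module.End K V} {F : ℤ → Submodule K V}
    (hE : ActsOn p d E F) (hF : Monotone F) {n : ℤ} {v : V} (hv : v ∈ F n) : E v ∈ F n := by
  have := (F n).add_mem (hF (by omega : n - 1 ≤ n) (hE n v hv))
    ((F n).smul_mem (p ^ ((d : ℤ) - 2 * n)) hv)
  simpa using this

/-- Level `t` of one flag is paired with level `d - t` of the opposite one; inverting the parameter
makes the two scalars agree. -/
theorem inv_zpow_sub (p : K) (d n : ℤ) : p⁻¹ ^ (d - 2 * (d - n)) = p ^ (d - 2 * n) := by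
  rw [inv_zpow, ← zpow_neg]
  congr 1
  ring

/-- An eigenvalue of `E` with an eigenvector in `F t` is one of the values on the factors up
to `t`. -/
theorem ActsOn.eigenvalue {p : K} {d : ℕ} {E : Module.End K V} {F : ℤ → Submodule K V}
    (hE : ActsOn p d E F) (hF : ∀ k < 0, F k = ⊥) {t : ℤ} {v : V} (hv : v ∈ F t) (h0 : v ≠ 0)
    {μ : K} (hμ : E v = μ • v) : ∃ n : ℤ, 0 ≤ n ∧ n ≤ t ∧ μ = p ^ ((d : ℤ) - 2 * n) := by
  suffices H : ∀ m : ℕ, ∀ t : ℤ, t < m → v ∈ F t →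
      ∃ n : ℤ, 0 ≤ n ∧ n ≤ t ∧ μ = p ^ ((d : ℤ) - 2 * n) from
    H (t.toNat + 1) t (by omega) hv
  intro m
  induction m with
  | zero =>
    intro t ht hvt
    rw [hF t (by exact_mod_cast ht)] at hvt
    exact absurd ((Submodule.mem_bot K).1 hvt) h0
  | succ m ih =>
    intro t ht hvt
    by_cases h : μ = p ^ ((d : ℤ) - 2 * t)
    · refine ⟨t, ?_, le_rfl, h⟩
      by_contra hneg
      rw [hF t (by omega)] at hvt
      exact h0 ((Submodule.mem_bot K).1 hvt)
    · have h1 := hE t v hvt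
      rw [hμ, ← sub_smul, Submodule.smul_mem_iff _ (sub_ne_zero.2 h)] at h1
      obtain ⟨n, hn0, hn, hn'⟩ := ih (t - 1) (by push_cast at ht; omega) h1
      exact ⟨n, hn0, by omega, hn'⟩

/-- An operator without a common eigenvalue on `F t` and `G (d - 1 - t)` separates them. -/
theorem disj_of_actsOn [IsAlgClosed K] [FiniteDimensional K V] {p : K} (hp : IsGeneric p)
    {d : ℕ} {E : Module.End K V} {F G : ℤ → Submodule K V} (hF : IsFlag d F) (hG : IsFlag d G)
    (hEF : ActsOn p d E F) (hEG : ActsOn p⁻¹ d E G) (t : ℤ) : F t ⊓ G (d - 1 - t) = ⊥ := by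
  by_contra hne
  have hinv : ∀ v ∈ F t ⊓ G (d - 1 - t), E v ∈ F t ⊓ G (d - 1 - t) :=
    fun v hv => ⟨hEF.mem hF.mono hv.1, hEG.mem hG.mono hv.2⟩
  have : Nontrivial ↥(F t ⊓ G (d - 1 - t)) := Submodule.nontrivial_iff_ne_bot.2 hne
  obtain ⟨μ, hμ⟩ := Module.End.exists_eigenvalue (E.restrict hinv)
  obtain ⟨⟨v, hv⟩, hv'⟩ := hμ.exists_hasEigenvector
  have hEv : E v = μ • v := congrArg Subtype.val hv'.apply_eq_smul
  have h0 : v ≠ 0 := fun h => hv'.2 (Subtype.ext h)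
  obtain ⟨n, -, hn, h1⟩ := hEF.eigenvalue hF.bot hv.1 h0 hEv
  obtain ⟨m, -, hm, h2⟩ := hEG.eigenvalue hG.bot hv.2 h0 hEv
  rw [h1, inv_zpow, ← zpow_neg] at h2
  -- Equal powers force `n + m = d`, whereas `n ≤ t` and `m ≤ d - 1 - t`.
  have := hp.zpow_inj h2
  omega

/-! ### Decomposition by opposite flags and the operators it determines -/

namespace OppositeFlags

variable {d : ℕ} {F G : ℤ → Submodule K V}

theorem symm (h : OppositeFlags d F G) : OppositeFlags d G F where
  left := h.right
  right := h.left
  disj t := by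
    rw [inf_comm, ← h.disj (d - 1 - t)]
    congr 2
    ring
  sup := by
    rw [← h.sup, ← (Equiv.subLeft (d : ℤ)).iSup_comp]
    refine iSup_congr fun t => ?_
    rw [inf_comm, Equiv.subLeft_apply, sub_sub_cancel]

theorem eq_bot (h : OppositeFlags d F G) {s t : ℤ} (hst : s + t < d) : F s ⊓ G t = ⊥ := by
  rw [eq_bot_iff, ← h.disj s]
  exact inf_le_inf_left _ (h.right.mono (by omega))

theorem eq_zero (h : OppositeFlags d F G) {s t : ℤ} (hst : s + t < d) {v : V} (h1 : v ∈ F s)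
    (h2 : v ∈ G t) : v = 0 := by
  have : v ∈ F s ⊓ G t := ⟨h1, h2⟩
  rwa [h.eq_bot hst, Submodule.mem_bot] at this

/-- The pieces before `t` lie in `F (t - 1)` and those after it in `G (d - t - 1)`. If `f + g` with
such `f`, `g` belongs to piece `t`, then `g` lies in `F t ⊓ G (d - t - 1) = ⊥`, and then `f` lies in
`F (t - 1) ⊓ G (d - t) = ⊥`. -/
theorem iSupIndep (h : OppositeFlags d F G) : iSupIndep fun t : ℤ => F t ⊓ G (d - t) := by
  intro t
  have hle : ⨆ (s : ℤ) (_ : s ≠ t), F s ⊓ G (d - s) ≤ F (t - 1) ⊔ G (d - t - 1) := by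
    refine iSup₂_le fun s hs => ?_
    rcases lt_or_gt_of_ne hs with hlt | hgt
    · exact (inf_le_left.trans (h.left.mono (by omega))).trans le_sup_left
    · exact (inf_le_right.trans (h.right.mono (by omega))).trans le_sup_right
  refine Disjoint.mono_right hle (Submodule.disjoint_def.2 ?_)
  rintro v ⟨hv1, hv2⟩ hv
  obtain ⟨f, hf, g, hg, rfl⟩ := Submodule.mem_sup.1 hv
  have hg' : g ∈ F t := by
    have := (F t).sub_mem hv1 (h.left.mono (by omega : t - 1 ≤ t) hf)
    simpa using this
  have hg0 : g = 0 := h.eq_zero (by omega) hg' hg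
  subst hg0
  rw [add_zero] at hv2 ⊢
  exact h.eq_zero (by omega) hf hv2

/-- The modular law applies: the pieces beyond `n` lie in `G (d - 1 - n)`, which meets `F n`
trivially. -/
theorem eq_iSup (h : OppositeFlags d F G) (n : ℤ) :
    F n = ⨆ (t : ℤ) (_ : t ≤ n), F t ⊓ G (d - t) := by
  have hA : ⨆ (t : ℤ) (_ : t ≤ n), F t ⊓ G (d - t) ≤ F n :=
    iSup₂_le fun t ht => inf_le_left.trans (h.left.mono ht)
  have hB : ⨆ (t : ℤ) (_ : ¬ t ≤ n), F t ⊓ G (d - t) ≤ G (d - 1 - n) :=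
    iSup₂_le fun t ht => inf_le_right.trans (h.right.mono (by omega))
  have htop : (⨆ (t : ℤ) (_ : t ≤ n), F t ⊓ G (d - t)) ⊔
      ⨆ (t : ℤ) (_ : ¬ t ≤ n), F t ⊓ G (d - t) = ⊤ := by
    rw [eq_top_iff, ← h.sup]
    refine iSup_le fun t => ?_
    by_cases ht : t ≤ n
    · exact le_sup_of_le_left (le_iSup₂_of_le t ht le_rfl)
    · exact le_sup_of_le_right (le_iSup₂_of_le t ht le_rfl)
  refine le_antisymm ?_ hA
  calc F n = ((⨆ (t : ℤ) (_ : t ≤ n), F t ⊓ G (d - t)) ⊔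
      ⨆ (t : ℤ) (_ : ¬ t ≤ n), F t ⊓ G (d - t)) ⊓ F n := by rw [htop, top_inf_eq]
    _ = (⨆ (t : ℤ) (_ : t ≤ n), F t ⊓ G (d - t)) ⊔
      (⨆ (t : ℤ) (_ : ¬ t ≤ n), F t ⊓ G (d - t)) ⊓ F n := sup_inf_assoc_of_le _ hA
    _ ≤ _ := by
      refine sup_le le_rfl (le_trans ?_ bot_le)
      rw [← h.disj n, inf_comm]
      exact inf_le_inf_left _ hB

theorem induction (h : OppositeFlags d F G) {P : V → Prop} (hmem : ∀ t, ∀ v ∈ F t, v ∈ G (d - t) → P v)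
    (hzero : P 0) (hadd : ∀ v w, P v → P w → P (v + w)) (v : V) : P v :=
  Submodule.iSup_induction _ (motive := P) (h.sup ▸ Submodule.mem_top : v ∈ ⨆ t : ℤ, F t ⊓ G (d - t))
    (fun t w hw => hmem t w hw.1 hw.2) hzero hadd

theorem ext (h : OppositeFlags d F G) {A B : Module.End K V}
    (hAB : ∀ t, ∀ v ∈ F t, v ∈ G (d - t) → A v = B v) : A = B :=
  LinearMap.ext fun v => h.induction (P := fun v => A v = B v) hAB (by simp)
    (fun v w hv hw => by rw [map_add, map_add, hv, hw]) v

/-- The scalars on the two flags coincide, so the error lies in `F (t - 1) ⊓ G (d - t - 1) = ⊥`. -/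
theorem apply_eq (h : OppositeFlags d F G) {p : K} {E : Module.End K V} (hF : ActsOn p d E F)
    (hG : ActsOn p⁻¹ d E G) {t : ℤ} {v : V} (h1 : v ∈ F t) (h2 : v ∈ G (d - t)) :
    E v = p ^ ((d : ℤ) - 2 * t) • v := by
  have h2' := hG _ v h2
  rw [inv_zpow_sub] at h2'
  exact sub_eq_zero.1 (h.eq_zero (by omega) (hF t v h1) h2')

theorem actsOn_left (h : OppositeFlags d F G) {p : K} {E : Module.End K V}
    (hE : ∀ t, ∀ v ∈ F t, v ∈ G (d - t) → E v = p ^ ((d : ℤ) - 2 * t) • v) : ActsOn p d E F := by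
  intro n v hv
  suffices H : F n ≤ (F (n - 1)).comap (E - p ^ ((d : ℤ) - 2 * n) • LinearMap.id) by
    simpa using H hv
  rw [h.eq_iSup n]
  refine iSup₂_le fun t ht w hw => ?_
  have : (E - p ^ ((d : ℤ) - 2 * n) • LinearMap.id : V →ₗ[K] V) w =
      (p ^ ((d : ℤ) - 2 * t) - p ^ ((d : ℤ) - 2 * n)) • w := by
    simp [hE t w hw.1 hw.2, sub_smul]
  rw [Submodule.mem_comap, this]
  rcases ht.eq_or_lt with rfl | hlt
  · simp
  · exact Submodule.smul_mem _ _ (h.left.mono (by omega) hw.1)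

theorem actsOn_right (h : OppositeFlags d F G) {p : K} {E : Module.End K V}
    (hE : ∀ t, ∀ v ∈ F t, v ∈ G (d - t) → E v = p ^ ((d : ℤ) - 2 * t) • v) :
    ActsOn p⁻¹ d E G := by
  refine h.symm.actsOn_left fun t v h1 h2 => ?_
  rw [hE _ v h2 (by rwa [sub_sub_cancel]), ← inv_zpow_sub, sub_sub_cancel]

/-- The operator with eigenvalue `p ^ (d - 2t)` on `F t ⊓ G (d - t)`. -/
theorem exists_actsOn (h : OppositeFlags d F G) (p : K) :
    ∃ E : Module.End K V, ActsOn p d E F ∧ ActsOn p⁻¹ d E G := by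
  classical
  have hint : DirectSum.IsInternal fun t : ℤ => F t ⊓ G (d - t) :=
    (DirectSum.isInternal_submodule_iff_iSupIndep_and_iSup_eq_top _).2 ⟨h.iSupIndep, h.sup⟩
  let e := LinearEquiv.ofBijective
    (DirectSum.coeLinearMap fun t : ℤ => F t ⊓ G (d - t)) hint
  let E : Module.End K V := e.toLinearMap ∘ₗ
    (DirectSum.lmap fun t : ℤ => p ^ ((d : ℤ) - 2 * t) • LinearMap.id) ∘ₗ e.symm.toLinearMap
  have hE : ∀ t, ∀ v ∈ F t, v ∈ G (d - t) → E v = p ^ ((d : ℤ) - 2 * t) • v := by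
    intro t v h1 h2
    have hv : e (DirectSum.lof K ℤ (fun t : ℤ => ↥(F t ⊓ G (d - t))) t ⟨v, h1, h2⟩) = v :=
      DirectSum.coeLinearMap_lof _ _ _
    have hv' := e.symm_apply_eq.2 hv.symm
    simp only [E, LinearMap.comp_apply, LinearEquiv.coe_coe, hv', DirectSum.lmap_lof,
      LinearMap.smul_apply, LinearMap.id_apply, map_smul, hv]
  exact ⟨E, h.actsOn_left hE, h.actsOn_right hE⟩

theorem unique (h : OppositeFlags d F G) {p : K} {E E' : Module.End K V} (h1 : ActsOn p d E F)
    (h2 : ActsOn p⁻¹ d E G) (h1' : ActsOn p d E' F) (h2' : ActsOn p⁻¹ d E' G) : E = E' :=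
  h.ext fun _ _ hv hv' => (h.apply_eq h1 h2 hv hv').trans (h.apply_eq h1' h2' hv hv').symm

/-- Strictness of `F` makes every piece nonzero: a zero piece `n` would give `F n = F (n - 1)` by
`eq_iSup`. -/
theorem hasEigenvalue_iff (h : OppositeFlags d F G) (hF : ∀ t : ℤ, 0 ≤ t → t ≤ d → F (t - 1) ≠ F t)
    {p : K} {E : Module.End K V} (h1 : ActsOn p d E F) (h2 : ActsOn p⁻¹ d E G) (μ : K) :
    E.HasEigenvalue μ ↔ ∃ n : ℕ, n ≤ d ∧ μ = p ^ ((d : ℤ) - 2 * (n : ℤ)) := by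
  constructor
  · intro hμ
    obtain ⟨v, hv⟩ := hμ.exists_hasEigenvector
    obtain ⟨n, hn0, hn, hn'⟩ := h1.eigenvalue h.left.bot (t := d) (v := v)
      (by rw [h.left.top _ le_rfl]; trivial) hv.2 hv.apply_eq_smul
    lift n to ℕ using hn0
    exact ⟨n, by exact_mod_cast hn, hn'⟩
  · rintro ⟨n, hn, rfl⟩
    have hne : F n ⊓ G (d - n) ≠ ⊥ := by
      intro hbot
      refine hF n (by omega) (by exact_mod_cast hn) (le_antisymm (h.left.mono (by omega)) ?_)
      rw [h.eq_iSup n]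
      refine iSup₂_le fun t ht => ?_
      rcases ht.eq_or_lt with rfl | hlt
      · rw [hbot]
        exact bot_le
      · exact inf_le_left.trans (h.left.mono (by omega))
    obtain ⟨v, hv, h0⟩ := Submodule.exists_mem_ne_zero_of_ne_bot hne
    exact Module.End.hasEigenvalue_of_hasEigenvector
      (x := v) ⟨Module.End.mem_eigenspace_iff.2 (h.apply_eq h1 h2 hv.1 hv.2), h0⟩

theorem isSemisimple (h : OppositeFlags d F G) {p : K} (hp : IsGeneric p)
    {E : Module.End K V} (h1 : ActsOn p d E F) (h2 : ActsOn p⁻¹ d E G) : E.IsSemisimple := by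
  let f : Polynomial K :=
    ∏ n ∈ Finset.range (d + 1), (Polynomial.X - Polynomial.C (p ^ ((d : ℤ) - 2 * (n : ℤ))))
  have hf : f.Separable := by
    refine Polynomial.separable_prod_X_sub_C_iff'.2 fun m _ n _ hmn => ?_
    have := hp.zpow_inj hmn
    omega
  refine Module.End.isSemisimple_of_squarefree_aeval_eq_zero hf.squarefree (h.ext ?_)
  intro t v hv hv'
  have hEv := h.apply_eq h1 h2 hv hv'
  by_cases h0 : v = 0
  · simp [h0]
  have ht0 : 0 ≤ t := by
    by_contra hneg
    rw [h.left.bot t (by omega)] at hv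
    exact h0 ((Submodule.mem_bot K).1 hv)
  have htd : t ≤ d := by
    by_contra hneg
    rw [h.right.bot (d - t) (by omega)] at hv'
    exact h0 ((Submodule.mem_bot K).1 hv')
  lift t to ℕ using ht0
  have hroot : f.eval (p ^ ((d : ℤ) - 2 * (t : ℤ))) = 0 := by
    rw [Polynomial.eval_prod]
    exact Finset.prod_eq_zero (Finset.mem_range.2 (show t < d + 1 by omega)) (by simp)
  rw [Module.End.aeval_apply_of_hasEigenvector (μ := p ^ ((d : ℤ) - 2 * (t : ℤ)))
    ⟨Module.End.mem_eigenspace_iff.2 hEv, h0⟩, hroot]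
  simp

end OppositeFlags

end Flags
/-! ### The `q`-Weyl and `q`-Serre relations -/

section Relations

variable {K : Type u} [Field K] {V : Type v} [AddCommGroup V] [Module K V]

/-- The `q`-Weyl relation `q ab - q⁻¹ ba = q - q⁻¹`. -/
def QWeyl (q : K) {A : Type*} [Ring A] [Algebra K A] (a b : A) : Prop :=
  q • (a * b) - q⁻¹ • (b * a) = (q - q⁻¹) • (1 : A)

theorem QWeyl.inv {q : K} {A : Type*} [Ring A] [Algebra K A] {a b : A} (h : QWeyl q a b) :
    QWeyl q⁻¹ b a := by
  unfold QWeyl at *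
  rw [inv_inv, ← neg_sub (q • (a * b)), h, ← neg_smul, neg_sub]

theorem qWeyl_inv_iff {q : K} {A : Type*} [Ring A] [Algebra K A] {a b : A} :
    QWeyl q⁻¹ b a ↔ QWeyl q a b :=
  ⟨fun h => by simpa using h.inv, QWeyl.inv⟩

theorem qSerre_inv (q : K) {A : Type*} [Ring A] [Algebra K A] (a b : A) :
    qSerre q⁻¹ a b = qSerre q a b := by
  have : qInt q⁻¹ 3 = qInt q 3 := by
    rw [qInt, qInt, inv_inv, ← neg_sub (q ^ 3), ← neg_sub q, neg_div_neg_eq]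
  rw [qSerre, qSerre, this]

/-- On an eigenvector for `a`, the q-Serre expression is `(X - a)(X - p²a)(X - p⁻²a)` applied to `Y
v`. The coefficients are left as symmetric functions of the three roots, the form that
`mem_of_cubic` takes. -/
theorem qSerre_apply_eq_zero_iff {p : K} (hp : IsGeneric p) {X Y : Module.End K V} {a : K} {v : V}
    (hv : X v = a • v) : qSerre p X Y v = 0 ↔
      X (X (X (Y v))) = (a + p ^ 2 * a + p⁻¹ ^ 2 * a) • X (X (Y v))
        - (a * (p ^ 2 * a) + p ^ 2 * a * (p⁻¹ ^ 2 * a) + p⁻¹ ^ 2 * a * a) • X (Y v)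
        + (a * (p ^ 2 * a) * (p⁻¹ ^ 2 * a)) • Y v := by
  have h0 := hp.ne_zero
  have h1 : p ^ 2 * p⁻¹ ^ 2 = 1 := by rw [← mul_pow, mul_inv_cancel₀ h0, one_pow]
  have e2 : a * (p ^ 2 * a) + p ^ 2 * a * (p⁻¹ ^ 2 * a) + p⁻¹ ^ 2 * a * a =
      (p ^ 2 + 1 + p⁻¹ ^ 2) * a ^ 2 := by linear_combination a ^ 2 * h1
  have e3 : a * (p ^ 2 * a) * (p⁻¹ ^ 2 * a) = a ^ 3 := by linear_combination a ^ 3 * h1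
  rw [e2, e3, ← sub_eq_zero (a := X (X (X (Y v))))]
  have : qSerre p X Y v = X (X (X (Y v))) - ((a + p ^ 2 * a + p⁻¹ ^ 2 * a) • X (X (Y v))
        - ((p ^ 2 + 1 + p⁻¹ ^ 2) * a ^ 2) • X (Y v) + a ^ 3 • Y v) := by
    simp only [qSerre, hp.qInt_three, LinearMap.sub_apply, LinearMap.add_apply,
      LinearMap.smul_apply, Module.End.mul_apply, pow_succ, pow_zero, one_mul, hv, map_smul]
    module
  rw [this]

/-- A vector killed by `(X - a)(X - b)(X - c)` is a sum of eigenvectors. -/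
theorem mem_of_cubic {X : Module.End K V} {a b c : K} (hab : a ≠ b) (hbc : b ≠ c) (hca : c ≠ a)
    {S : Submodule K V} (ha : X.eigenspace a ≤ S) (hb : X.eigenspace b ≤ S)
    (hc : X.eigenspace c ≤ S) {w : V}
    (hw : X (X (X w)) = (a + b + c) • X (X w) - (a * b + b * c + c * a) • X w + (a * b * c) • w) :
    w ∈ S := by
  have key : ∀ a' b' c' : K, a' + b' + c' = a + b + c →
      a' * b' + b' * c' + c' * a' = a * b + b * c + c * a → a' * b' * c' = a * b * c →
      X.eigenspace a' ≤ S → X (X w) - (b' + c') • X w + (b' * c') • w ∈ S := by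
    intro a' b' c' h1 h2 h3 h
    refine h (Module.End.mem_eigenspace_iff.2 ?_)
    rw [map_add, map_sub, map_smul, map_smul, hw, ← h1, ← h2, ← h3]
    module
  have h1 := S.smul_mem (b - c) (key a b c rfl rfl rfl ha)
  have h2 := S.smul_mem (c - a) (key b c a (by ring) (by ring) (by ring) hb)
  have h3 := S.smul_mem (a - b) (key c a b (by ring) (by ring) (by ring) hc)
  have h := S.add_mem (S.add_mem h1 h2) h3
  -- This is Lagrange interpolation: the quadratic and linear terms cancel and a Vandermonde
  -- determinant remains.
  have e : (b - c) • (X (X w) - (b + c) • X w + (b * c) • w) +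
      (c - a) • (X (X w) - (c + a) • X w + (c * a) • w) +
      (a - b) • (X (X w) - (a + b) • X w + (a * b) • w) =
      (-((a - b) * (b - c) * (c - a))) • w := by module
  rw [e] at h
  exact (Submodule.smul_mem_iff _ (neg_ne_zero.2 (mul_ne_zero (mul_ne_zero (sub_ne_zero.2 hab)
    (sub_ne_zero.2 hbc)) (sub_ne_zero.2 hca)))).1 h

theorem IsGeneric.sq_mul_zpow {p : K} (hp : IsGeneric p) (d n : ℤ) :
    p ^ 2 * p ^ (d - 2 * n) = p ^ (d - 2 * (n - 1)) := by
  rw [← zpow_natCast, ← zpow_add₀ hp.ne_zero]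
  congr 1
  push_cast
  ring

theorem IsGeneric.inv_sq_mul_zpow {p : K} (hp : IsGeneric p) (d n : ℤ) :
    p⁻¹ ^ 2 * p ^ (d - 2 * n) = p ^ (d - 2 * (n + 1)) := by
  rw [inv_pow, ← zpow_natCast, ← zpow_neg, ← zpow_add₀ hp.ne_zero]
  congr 1
  push_cast
  ring

/-- The `q`-Serre relation makes `Y` block tridiagonal with respect to the eigenspaces of `X`. -/
theorem mem_of_qSerre {p : K} (hp : IsGeneric p) {X Y : Module.End K V} (hXY : qSerre p X Y = 0)
    {d n : ℤ} {v : V} (hv : v ∈ X.eigenspace (p ^ (d - 2 * n))) {S : Submodule K V}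
    (h1 : X.eigenspace (p ^ (d - 2 * (n - 1))) ≤ S) (h2 : X.eigenspace (p ^ (d - 2 * n)) ≤ S)
    (h3 : X.eigenspace (p ^ (d - 2 * (n + 1))) ≤ S) : Y v ∈ S := by
  have hv' := Module.End.mem_eigenspace_iff.1 hv
  have hw := (qSerre_apply_eq_zero_iff hp (Y := Y) hv').1 (by rw [hXY, LinearMap.zero_apply])
  rw [hp.sq_mul_zpow, hp.inv_sq_mul_zpow] at hw
  refine mem_of_cubic ?_ ?_ ?_ h2 h1 h3 hw <;>
  · intro h
    have := hp.zpow_inj h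
    omega

/-- The `q`-Weyl relation on an eigenvector of the first operator. -/
theorem QWeyl.apply_eq {p : K} (hp : p ≠ 0) {X Z : Module.End K V} (h : QWeyl p X Z) {a : K}
    (ha : a ≠ 0) {v : V} (hv : X v = a • v) :
    X (Z v - a⁻¹ • v) = (p⁻¹ ^ 2 * a) • (Z v - a⁻¹ • v) := by
  have h1 : p • X (Z v) = (p⁻¹ * a) • Z v + (p - p⁻¹) • v := by
    have := congrArg (fun f : Module.End K V => f v) h
    simp only [LinearMap.sub_apply, LinearMap.smul_apply, Module.End.mul_apply, hv, map_smul,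
      Module.End.one_apply] at this
    rw [← this]
    module
  have h2 : X (Z v) = (p⁻¹ ^ 2 * a) • Z v + (1 - p⁻¹ ^ 2) • v := by
    have := congrArg (fun w => p⁻¹ • w) h1
    simp only [smul_smul, smul_add] at this
    rw [inv_mul_cancel₀ hp, one_smul] at this
    rw [this]
    congr 2
    · ring
    · field_simp
  rw [map_sub, map_smul, hv, h2]
  match_scalars
  · ring
  · field_simp
    ring

/-! ### The flags of a diagonalizable operator -/

/-- `X` is diagonalizable with eigenvalues `p ^ (d - 2n)`, `0 ≤ n ≤ d`. -/
structure QDiagonal (p : K) (d : ℕ) (X : Module.End K V) : Prop where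
  sup : ⨆ n : ℤ, X.eigenspace (p ^ ((d : ℤ) - 2 * n)) = ⊤
  bot : ∀ n : ℤ, ¬(0 ≤ n ∧ n ≤ d) → X.eigenspace (p ^ ((d : ℤ) - 2 * n)) = ⊥
  ne_bot : ∀ n : ℤ, 0 ≤ n → n ≤ d → X.eigenspace (p ^ ((d : ℤ) - 2 * n)) ≠ ⊥

theorem QDiagonal.inv {p : K} {d : ℕ} {X : Module.End K V} (h : QDiagonal p d X) :
    QDiagonal p⁻¹ d X := by
  have e : ∀ n : ℤ, p⁻¹ ^ ((d : ℤ) - 2 * n) = p ^ ((d : ℤ) - 2 * (d - n)) := by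
    intro n
    rw [← inv_zpow_sub p⁻¹, inv_inv]
  refine ⟨?_, fun n hn => ?_, fun n hn hn' => ?_⟩
  · rw [← h.sup, ← (Equiv.subLeft (d : ℤ)).iSup_comp]
    simp only [e, Equiv.subLeft_apply, sub_sub_cancel]
  · rw [e]
    exact h.bot _ (by omega)
  · rw [e]
    exact h.ne_bot _ (by omega) (by omega)

/-- The flag of sums of eigenspaces of `X` for the eigenvalues `p ^ d, p ^ (d - 2), …`. -/
def qFlag (p : K) (d : ℕ) (X : Module.End K V) (k : ℤ) : Submodule K V :=
  ⨆ (n : ℤ) (_ : 0 ≤ n ∧ n ≤ k), X.eigenspace (p ^ ((d : ℤ) - 2 * n))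

theorem eigenspace_le_qFlag {p : K} {d : ℕ} {X : Module.End K V} {n k : ℤ} (h0 : 0 ≤ n)
    (h : n ≤ k) : X.eigenspace (p ^ ((d : ℤ) - 2 * n)) ≤ qFlag p d X k :=
  le_iSup₂_of_le n ⟨h0, h⟩ le_rfl

theorem QDiagonal.eigenspace_le {p : K} {d : ℕ} {X : Module.End K V} (h : QDiagonal p d X)
    {n k : ℤ} (hnk : n ≤ k) : X.eigenspace (p ^ ((d : ℤ) - 2 * n)) ≤ qFlag p d X k := by
  by_cases hn : 0 ≤ n
  · exact eigenspace_le_qFlag hn hnk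
  · rw [h.bot n (by omega)]
    exact bot_le

theorem qFlag_induction {p : K} {d : ℕ} {X A : Module.End K V} {k : ℤ} {S : Submodule K V}
    (h : ∀ n : ℤ, 0 ≤ n → n ≤ k → ∀ v, X v = p ^ ((d : ℤ) - 2 * n) • v → A v ∈ S) {v : V}
    (hv : v ∈ qFlag p d X k) : A v ∈ S := by
  suffices H : qFlag p d X k ≤ S.comap A from H hv
  exact iSup₂_le fun n hn w hw => h n hn.1 hn.2 w (Module.End.mem_eigenspace_iff.1 hw)

theorem QDiagonal.isFlag {p : K} {d : ℕ} {X : Module.End K V} (h : QDiagonal p d X) :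
    IsFlag d (qFlag p d X) where
  mono k l hkl := iSup₂_le fun n hn => eigenspace_le_qFlag hn.1 (hn.2.trans hkl)
  bot k hk := by
    rw [eq_bot_iff]
    exact iSup₂_le fun n hn => by omega
  top k hk := by
    rw [eq_top_iff, ← h.sup]
    refine iSup_le fun n => ?_
    by_cases hn : 0 ≤ n ∧ n ≤ d
    · exact eigenspace_le_qFlag hn.1 (by omega)
    · rw [h.bot n hn]
      exact bot_le

theorem qFlag_actsOn (p : K) (d : ℕ) (X : Module.End K V) : ActsOn p d X (qFlag p d X) := by
  intro k v hv
  suffices H : (X - p ^ ((d : ℤ) - 2 * k) • LinearMap.id : V →ₗ[K] V) v ∈ qFlag p d X (k - 1) by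
    simpa using H
  refine qFlag_induction (fun n h0 hn w hw => ?_) hv
  have : (X - p ^ ((d : ℤ) - 2 * k) • LinearMap.id : V →ₗ[K] V) w =
      (p ^ ((d : ℤ) - 2 * n) - p ^ ((d : ℤ) - 2 * k)) • w := by simp [hw, sub_smul]
  rw [this]
  rcases hn.eq_or_lt with rfl | hlt
  · simp
  · exact Submodule.smul_mem _ _
      (eigenspace_le_qFlag h0 (by omega) (Module.End.mem_eigenspace_iff.2 hw))

theorem QDiagonal.strict {p : K} (hp : IsGeneric p) {d : ℕ} {X : Module.End K V}
    (h : QDiagonal p d X) (t : ℤ) (h0 : 0 ≤ t) (htd : t ≤ d) :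
    qFlag p d X (t - 1) ≠ qFlag p d X t := by
  intro he
  obtain ⟨v, hv, hv0⟩ := Submodule.exists_mem_ne_zero_of_ne_bot (h.ne_bot t h0 htd)
  have hv' := eigenspace_le_qFlag h0 le_rfl hv
  rw [← he] at hv'
  obtain ⟨n, -, hn, hn'⟩ := (qFlag_actsOn p d X).eigenvalue h.isFlag.bot hv' hv0
    (Module.End.mem_eigenspace_iff.1 hv)
  have := hp.zpow_inj hn'
  omega

theorem QDiagonal.opposite [IsAlgClosed K] [FiniteDimensional K V] {p : K} (hp : IsGeneric p)
    {d : ℕ} {X : Module.End K V} (h : QDiagonal p d X) :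
    OppositeFlags d (qFlag p d X) (qFlag p⁻¹ d X) where
  left := h.isFlag
  right := h.inv.isFlag
  disj := disj_of_actsOn hp h.isFlag h.inv.isFlag (qFlag_actsOn p d X) (qFlag_actsOn p⁻¹ d X)
  sup := by
    rw [eq_top_iff, ← h.sup]
    refine iSup_mono fun n => le_inf (h.eigenspace_le le_rfl) ?_
    have := h.inv.eigenspace_le (le_refl ((d : ℤ) - n))
    rwa [inv_zpow_sub] at this

theorem QDiagonal.raises_of_qSerre {p : K} (hp : IsGeneric p) {d : ℕ} {X Y : Module.End K V}
    (h : QDiagonal p d X) (hXY : qSerre p X Y = 0) : Raises Y (qFlag p d X) := by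
  intro k v hv
  refine qFlag_induction (fun n h0 hn w hw => ?_) hv
  exact mem_of_qSerre hp hXY (Module.End.mem_eigenspace_iff.2 hw) (h.eigenspace_le (by omega))
    (h.eigenspace_le (by omega)) (h.eigenspace_le (by omega))

/-- `Z - a⁻¹` maps the `a`-eigenspace of `X` into the one for `p⁻² a`. In the order of `qFlag p⁻¹ d
X` this is the preceding eigenspace, and `a⁻¹` is the required scalar `p ^ (d - 2n)`. -/
theorem QWeyl.actsOn {p : K} (hp : IsGeneric p) {d : ℕ} {X Z : Module.End K V}
    (hX : QDiagonal p⁻¹ d X) (h : QWeyl p X Z) : ActsOn p d Z (qFlag p⁻¹ d X) := by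
  intro k v hv
  suffices H : (Z - p ^ ((d : ℤ) - 2 * k) • LinearMap.id : V →ₗ[K] V) v ∈
      qFlag p⁻¹ d X (k - 1) by
    simpa using H
  refine qFlag_induction (fun n h0 hn w hw => ?_) hv
  have h1 := h.apply_eq hp.ne_zero (zpow_ne_zero _ hp.inv.ne_zero) hw
  have e := hp.inv.sq_mul_zpow d n
  rw [e, ← inv_zpow, inv_inv] at h1
  have : (Z - p ^ ((d : ℤ) - 2 * k) • LinearMap.id : V →ₗ[K] V) w =
      (Z w - p ^ ((d : ℤ) - 2 * n) • w) + (p ^ ((d : ℤ) - 2 * n) - p ^ ((d : ℤ) - 2 * k)) • w := by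
    simp [sub_smul]
  rw [this]
  refine Submodule.add_mem _ (hX.eigenspace_le (by omega) (Module.End.mem_eigenspace_iff.2 h1)) ?_
  rcases hn.eq_or_lt with rfl | hlt
  · simp
  · exact Submodule.smul_mem _ _
      (eigenspace_le_qFlag h0 (by omega) (Module.End.mem_eigenspace_iff.2 hw))

/-- The shift of eigenspaces is the same as in `QWeyl.actsOn`, but in the order of `qFlag p d X` it
leads to the following eigenspace. -/
theorem QWeyl.raises {p : K} (hp : IsGeneric p) {d : ℕ} {X Z : Module.End K V}
    (h : QWeyl p X Z) : Raises Z (qFlag p d X) := by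
  intro k v hv
  refine qFlag_induction (fun n h0 hn w hw => ?_) hv
  have h1 := h.apply_eq hp.ne_zero (zpow_ne_zero _ hp.ne_zero) hw
  rw [hp.inv_sq_mul_zpow] at h1
  have h2 := eigenspace_le_qFlag (k := k + 1) (by omega) (by omega)
    (Module.End.mem_eigenspace_iff.2 h1)
  have h3 := eigenspace_le_qFlag (k := k + 1) h0 (by omega) (Module.End.mem_eigenspace_iff.2 hw)
  have := Submodule.add_mem _ h2 (Submodule.smul_mem _ (p ^ ((d : ℤ) - 2 * n))⁻¹ h3)
  simpa using this

/-! ### Relations from the action on flags -/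

/-- For `v` in piece `t`, subtracting the scalar of `X` on `F` leaves a vector of piece `t - 1`. It
is an eigenvector of `E` whose eigenvalue is `p²` times that of `v`, and this is the q-Weyl relation
on `v`. -/
theorem OppositeFlags.qWeyl {d : ℕ} {F G : ℤ → Submodule K V} (h : OppositeFlags d F G) {p : K}
    (hp : IsGeneric p) {X E : Module.End K V} (hEF : ActsOn p d E F) (hEG : ActsOn p⁻¹ d E G)
    (hXF : ActsOn p⁻¹ d X F) (hXG : Raises X G) : QWeyl p X E := by
  refine h.ext fun t v hv hv' => ?_
  have hE := h.apply_eq hEF hEG hv hv'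
  have hwF := hXF t v hv
  have hwG : X v - p⁻¹ ^ ((d : ℤ) - 2 * t) • v ∈ G (d - (t - 1)) := by
    have e : (d : ℤ) - (t - 1) = d - t + 1 := by ring
    rw [e]
    exact Submodule.sub_mem _ (hXG _ v hv')
      (Submodule.smul_mem _ _ (h.right.mem_of_le (by omega) hv'))
  have hEw := h.apply_eq hEF hEG hwF hwG
  rw [← hp.sq_mul_zpow, inv_zpow, map_sub, map_smul, hE, smul_smul,
    inv_mul_cancel₀ (zpow_ne_zero _ hp.ne_zero), one_smul, sub_eq_iff_eq_add] at hEw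
  have h0 := hp.ne_zero
  have ha : p ^ ((d : ℤ) - 2 * t) ≠ 0 := zpow_ne_zero _ h0
  simp only [LinearMap.sub_apply, LinearMap.smul_apply, Module.End.mul_apply,
    Module.End.one_apply, hE, map_smul, hEw]
  generalize p ^ ((d : ℤ) - 2 * t) = a at ha
  match_scalars <;> field_simp
  · ring
  · ring

/-- For `v` in piece `t`, `B v` lies in `F (t + 1) ⊓ G (d - t + 1)`. There `E - c` lowers the
`F`-index and `E - b` the `G`-index, which leads back to piece `t`, where `E` is the scalar `a`. So
`B v` is killed by the cubic of `qSerre_apply_eq_zero_iff`. -/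
theorem OppositeFlags.qSerre_eq_zero {d : ℕ} {F G : ℤ → Submodule K V} (h : OppositeFlags d F G)
    {p : K} (hp : IsGeneric p) {E B : Module.End K V} (hEF : ActsOn p d E F)
    (hEG : ActsOn p⁻¹ d E G) (hBF : Raises B F) (hBG : Raises B G) : qSerre p E B = 0 := by
  refine h.ext fun t v hv hv' => ?_
  rw [LinearMap.zero_apply, qSerre_apply_eq_zero_iff hp (h.apply_eq hEF hEG hv hv'),
    hp.sq_mul_zpow, hp.inv_sq_mul_zpow]
  have hF1 := hBF t v hv
  have hG1 := hBG _ v hv'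
  set w := B v
  set a := p ^ ((d : ℤ) - 2 * t)
  set b := p ^ ((d : ℤ) - 2 * (t - 1)) with hb
  set c := p ^ ((d : ℤ) - 2 * (t + 1))
  have hF2 := hEF _ w hF1
  have hG2 : E w - c • w ∈ G (d - t + 1) :=
    Submodule.sub_mem _ (hEG.mem h.right.mono hG1) (Submodule.smul_mem _ _ hG1)
  set w1 := E w - c • w with hw1
  rw [add_sub_cancel_right] at hF2
  have e : p⁻¹ ^ ((d : ℤ) - 2 * (d - t + 1)) = b := by
    rw [hb, ← inv_zpow_sub p, sub_sub_eq_add_sub, add_sub_right_comm]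
  have hF3 : E w1 - b • w1 ∈ F t :=
    Submodule.sub_mem _ (hEF.mem h.left.mono hF2) (Submodule.smul_mem _ _ hF2)
  have hG3 := hEG _ w1 hG2
  rw [e, add_sub_cancel_right] at hG3
  have h4 := h.apply_eq hEF hEG hF3 hG3
  simp only [hw1, map_sub, map_smul] at h4
  rw [← sub_eq_zero] at h4 ⊢
  rw [← h4]
  module

/-- The commutator identity behind `qWeyl_of_qWeyl_of_qWeyl`. -/
theorem commute_of_qWeyl {A : Type*} [Ring A] [Algebra K A] {p : K} (hp : p ≠ 0) {x z w : A}
    (h1 : QWeyl p x z) (h2 : QWeyl p w x) :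
    x * (p • (z * w) - p⁻¹ • (w * z)) = (p • (z * w) - p⁻¹ • (w * z)) * x := by
  have hz : x * z = (p⁻¹ ^ 2) • (z * x) + (p⁻¹ * (p - p⁻¹)) • 1 := by
    have := congrArg (fun y => p⁻¹ • y) h1
    simp only [smul_sub, smul_smul, inv_mul_cancel₀ hp, one_smul] at this
    rw [sub_eq_iff_eq_add.1 this]
    module
  have hw : x * w = (p ^ 2) • (w * x) - (p * (p - p⁻¹)) • 1 := by
    have := congrArg (fun y => p • y) h2
    simp only [smul_sub, smul_smul, mul_inv_cancel₀ hp, one_smul] at this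
    rw [← this]
    module
  have e1 : x * (z * w) = z * (w * x) - (p⁻¹ ^ 2 * (p * (p - p⁻¹))) • z
      + (p⁻¹ * (p - p⁻¹)) • w := by
    rw [← mul_assoc, hz, add_mul, smul_mul_assoc, mul_assoc, hw, mul_sub, smul_mul_assoc, one_mul,
      mul_smul_comm, mul_smul_comm, mul_one, smul_sub, smul_smul, smul_smul]
    rw [← mul_pow, inv_mul_cancel₀ hp, one_pow, one_smul]
  have e2 : x * (w * z) = w * (z * x) + (p ^ 2 * (p⁻¹ * (p - p⁻¹))) • w
      - (p * (p - p⁻¹)) • z := by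
    rw [← mul_assoc, hw, sub_mul, smul_mul_assoc, mul_assoc, hz, mul_add, smul_mul_assoc, one_mul,
      mul_smul_comm, mul_smul_comm, mul_one, smul_add, smul_smul, smul_smul]
    rw [← mul_pow, mul_inv_cancel₀ hp, one_pow, one_smul]
  rw [mul_sub, sub_mul, mul_smul_comm, mul_smul_comm, smul_mul_assoc, smul_mul_assoc, e1, e2,
    mul_assoc, mul_assoc]
  match_scalars <;> field_simp <;> ring

/-- Two relations of a face give the third. The q-commutator `T` of `Z` and `W` commutes with `X`,
so it preserves the flag of `X`; on the factors of `F` the scalars of `Z` and `W` are inverse, so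
`T` acts there as `p - p⁻¹`. The error lies in `F (t - 1)` and in level `d - t` of the flag of `X`,
hence vanishes. -/
theorem qWeyl_of_qWeyl_of_qWeyl {p : K} (hp : IsGeneric p) {d : ℕ} {X Z W : Module.End K V}
    {F : ℤ → Submodule K V} (h : OppositeFlags d F (qFlag p d X)) (h1 : QWeyl p X Z)
    (h2 : QWeyl p W X) (hZ : ActsOn p⁻¹ d Z F) (hW : ActsOn p d W F) : QWeyl p Z W := by
  refine h.ext fun t v hv hv' => ?_
  set T : Module.End K V := p • (Z * W) - p⁻¹ • (W * Z) with hT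
  have hcomm : X * T = T * X := commute_of_qWeyl hp.ne_zero h1 h2
  have hTG : T v ∈ qFlag p d X (d - t) := by
    refine qFlag_induction (fun n h0 hn w hw => ?_) hv'
    refine eigenspace_le_qFlag h0 hn (Module.End.mem_eigenspace_iff.2 ?_)
    rw [← Module.End.mul_apply, hcomm, Module.End.mul_apply, hw, map_smul]
  have hTF : T v - (p - p⁻¹) • v ∈ F (t - 1) := by
    have hWv := hW t v hv
    have hZv := hZ t v hv
    rw [inv_zpow] at hZv
    have h0 := hp.ne_zero
    have ha : p ^ ((d : ℤ) - 2 * t) ≠ 0 := zpow_ne_zero _ h0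
    generalize p ^ ((d : ℤ) - 2 * t) = a at ha hWv hZv
    have m1 := Submodule.smul_mem _ p (Submodule.add_mem _ (hZ.mem h.left.mono hWv)
      (Submodule.smul_mem _ a hZv))
    have m2 := Submodule.smul_mem _ p⁻¹ (Submodule.add_mem _ (hW.mem h.left.mono hZv)
      (Submodule.smul_mem _ a⁻¹ hWv))
    have m := Submodule.sub_mem _ m1 m2
    convert m using 1
    simp only [hT, LinearMap.sub_apply, LinearMap.smul_apply, Module.End.mul_apply, map_sub,
      map_smul]
    match_scalars <;> field_simp <;> ring
  refine sub_eq_zero.1 (h.eq_zero (s := t - 1) (t := d - t) (by omega) hTF ?_)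
  exact Submodule.sub_mem _ hTG (Submodule.smul_mem _ _ hv')

/-- With `w = A v - a v` one has `B v - a⁻¹ v = -a⁻¹ B w`. That `B` keeps `w` in `F (n - 1)` is the
induction hypothesis; the induction starts at negative indices, where the flag is zero. -/
theorem ActsOn.inv {p : K} (hp : p ≠ 0) {d : ℕ} {F : ℤ → Submodule K V} (hF : IsFlag d F)
    {A B : Module.End K V} (hA : ActsOn p d A F) (hBA : B * A = 1) : ActsOn p⁻¹ d B F := by
  suffices H : ∀ m : ℕ, ∀ n : ℤ, n < m → ∀ v ∈ F n,
      B v - p⁻¹ ^ ((d : ℤ) - 2 * n) • v ∈ F (n - 1) from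
    fun n v hv => H (n.toNat + 1) n (by omega) v hv
  intro m
  induction m with
  | zero =>
    intro n hn v hv
    rw [hF.bot n (by exact_mod_cast hn), Submodule.mem_bot] at hv
    simp [hv]
  | succ m ih =>
    intro n hn v hv
    have h1 := hA n v hv
    set w := A v - p ^ ((d : ℤ) - 2 * n) • v with hw
    have h2 := ih (n - 1) (by push_cast at hn; omega) w h1
    have h3 : B w ∈ F (n - 1) := by
      have := Submodule.add_mem _ (hF.mem_of_le (by omega) h2)
        (Submodule.smul_mem _ (p⁻¹ ^ ((d : ℤ) - 2 * (n - 1))) h1)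
      simpa using this
    have hBw : B w = v - p ^ ((d : ℤ) - 2 * n) • B v := by
      rw [hw, map_sub, map_smul, ← Module.End.mul_apply, hBA, Module.End.one_apply]
    have ha : p ^ ((d : ℤ) - 2 * n) ≠ 0 := zpow_ne_zero _ hp
    have : B v - p⁻¹ ^ ((d : ℤ) - 2 * n) • v = (-(p ^ ((d : ℤ) - 2 * n))⁻¹) • B w := by
      rw [hBw, inv_zpow, smul_sub, smul_smul, neg_mul, inv_mul_cancel₀ ha]
      module
    rw [this]
    exact Submodule.smul_mem _ _ h3

end Relations
/-! ### The four flags of a `q`-Serre pair -/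

section Tetrahedron

variable {K : Type u} [Field K] {V : Type v} [AddCommGroup V] [Module K V]

/-- `X` minus its scalar on `F` moves the term `t` into the term `t - 1`. The factor `W` is `⊤` in
the construction of the action and a minimal invariant subspace in the converse. -/
theorem iSup_inf_invariant_left {p : K} {d : ℕ} {X : Module.End K V} {F G : ℤ → Submodule K V}
    {W : Submodule K V} (hW : ∀ v ∈ W, X v ∈ W) (hF : ActsOn p d X F) (hGm : Monotone G)
    (hG : Raises X G) (s : ℤ) {v : V} (hv : v ∈ ⨆ t : ℤ, W ⊓ (F t ⊓ G (s - t))) :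
    X v ∈ ⨆ t : ℤ, W ⊓ (F t ⊓ G (s - t)) := by
  suffices H : ⨆ t : ℤ, W ⊓ (F t ⊓ G (s - t)) ≤ (⨆ t : ℤ, W ⊓ (F t ⊓ G (s - t))).comap X from H hv
  refine iSup_le fun t w hw => ?_
  obtain ⟨hwW, hwF, hwG⟩ := hw
  have h1 : X w - p ^ ((d : ℤ) - 2 * t) • w ∈ W ⊓ (F (t - 1) ⊓ G (s - (t - 1))) := by
    refine ⟨W.sub_mem (hW w hwW) (W.smul_mem _ hwW), hF t w hwF, ?_⟩
    rw [sub_sub_eq_add_sub, add_sub_right_comm]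
    exact Submodule.sub_mem _ (hG _ w hwG) (Submodule.smul_mem _ _ (hGm (by omega) hwG))
  have h2 := Submodule.add_mem _ (le_iSup (fun t : ℤ => W ⊓ (F t ⊓ G (s - t))) (t - 1) h1)
    (Submodule.smul_mem _ (p ^ ((d : ℤ) - 2 * t))
      (le_iSup (fun t : ℤ => W ⊓ (F t ⊓ G (s - t))) t ⟨hwW, hwF, hwG⟩))
  simpa using h2

theorem iSup_inf_comm (W : Submodule K V) (F G : ℤ → Submodule K V) (s : ℤ) :
    ⨆ t : ℤ, W ⊓ (F t ⊓ G (s - t)) = ⨆ t : ℤ, W ⊓ (G t ⊓ F (s - t)) := by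
  rw [← (Equiv.subLeft s).iSup_comp]
  refine iSup_congr fun t => ?_
  rw [Equiv.subLeft_apply, sub_sub_cancel, inf_comm (F _)]

theorem iSup_inf_invariant_right {p : K} {d : ℕ} {X : Module.End K V} {F G : ℤ → Submodule K V}
    {W : Submodule K V} (hW : ∀ v ∈ W, X v ∈ W) (hG : ActsOn p d X G) (hFm : Monotone F)
    (hF : Raises X F) (s : ℤ) {v : V} (hv : v ∈ ⨆ t : ℤ, W ⊓ (F t ⊓ G (s - t))) :
    X v ∈ ⨆ t : ℤ, W ⊓ (F t ⊓ G (s - t)) := by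
  rw [iSup_inf_comm] at hv ⊢
  exact iSup_inf_invariant_left hW hG hFm hF s hv

/-- No proper nonzero subspace is invariant under both `X` and `Y`. -/
def JointlyIrreducible (X Y : Module.End K V) : Prop :=
  ∀ W : Submodule K V, (∀ v ∈ W, X v ∈ W) → (∀ v ∈ W, Y v ∈ W) → W = ⊥ ∨ W = ⊤

/-- Each sum with fixed `s` is zero or everything. For `s = d - 1` it lies in `F (d - 1) ≠ ⊤`,
because the terms with `t ≥ d` have a negative `G`-index. For `s = d` the term `t = 0` is `F 0 ≠ ⊥`.
-/
theorem JointlyIrreducible.opposite {X Y : Module.End K V} (h : JointlyIrreducible X Y)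
    {p p' : K} {d : ℕ} {F G : ℤ → Submodule K V} (hF : IsFlag d F) (hG : IsFlag d G)
    (hXF : ActsOn p d X F) (hXG : Raises X G) (hYG : ActsOn p' d Y G) (hYF : Raises Y F)
    (h0 : F 0 ≠ ⊥) (hd : F (d - 1) ≠ ⊤) : OppositeFlags d F G := by
  have H : ∀ s : ℤ, ⨆ t : ℤ, F t ⊓ G (s - t) = ⊥ ∨ ⨆ t : ℤ, F t ⊓ G (s - t) = ⊤ := by
    intro s
    have e : ⨆ t : ℤ, F t ⊓ G (s - t) = ⨆ t : ℤ, ⊤ ⊓ (F t ⊓ G (s - t)) := by simp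
    rw [e]
    exact h _ (fun v hv => iSup_inf_invariant_left (by simp) hXF hG.mono hXG s hv)
      (fun v hv => iSup_inf_invariant_right (by simp) hYG hF.mono hYF s hv)
  refine ⟨hF, hG, fun t => ?_, (H d).resolve_left fun hbot => h0 ?_⟩
  · have hne : ⨆ t : ℤ, F t ⊓ G ((d : ℤ) - 1 - t) ≠ ⊤ := by
      intro htop
      refine hd (eq_top_iff.2 ?_)
      rw [← htop]
      refine iSup_le fun t => ?_
      by_cases ht : t ≤ d - 1
      · exact inf_le_left.trans (hF.mono ht)
      · rw [hG.bot _ (by omega), inf_bot_eq]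
        exact bot_le
    rw [eq_bot_iff, ← (H _).resolve_right hne]
    exact le_iSup (fun t : ℤ => F t ⊓ G ((d : ℤ) - 1 - t)) t
  · rw [eq_bot_iff, ← hbot]
    refine le_trans ?_ (le_iSup (fun t : ℤ => F t ⊓ G ((d : ℤ) - t)) 0)
    rw [hG.top _ (by omega), inf_top_eq]

/-- Diagonalizable `X`, `Y` with spectrum `q ^ (d - 2n)` that satisfy the `q`-Serre relations. -/
structure IsSerrePair (q : K) (d : ℕ) (X Y : Module.End K V) : Prop where
  diag_left : QDiagonal q d X
  diag_right : QDiagonal q d Y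
  serre_left : qSerre q X Y = 0
  serre_right : qSerre q Y X = 0

theorem QDiagonal.bot_ne {p : K} (hp : IsGeneric p) {d : ℕ} {X : Module.End K V}
    (h : QDiagonal p d X) : qFlag p d X 0 ≠ ⊥ := by
  rw [← h.isFlag.bot (0 - 1) (by omega)]
  exact (h.strict hp 0 le_rfl (by omega)).symm

theorem QDiagonal.ne_top {p : K} (hp : IsGeneric p) {d : ℕ} {X : Module.End K V}
    (h : QDiagonal p d X) : qFlag p d X (d - 1) ≠ ⊤ := by
  rw [← h.isFlag.top d le_rfl]
  exact h.strict hp d (by omega) le_rfl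

theorem ZMod.forall_four {P : ZMod 4 → Prop} (h0 : P 0) (h1 : P 1) (h2 : P 2) (h3 : P 3)
    (i : ZMod 4) : P i := by
  fin_cases i
  exacts [h0, h1, h2, h3]

/-- The flags attached to the vertices of the tetrahedron. -/
def tetFlag (q : K) (d : ℕ) (X Y : Module.End K V) (i : ZMod 4) : ℤ → Submodule K V :=
  (![qFlag q d X, qFlag q⁻¹ d X, qFlag q d Y, qFlag q⁻¹ d Y] : Fin 4 → ℤ → Submodule K V) i

/-- Two flags of the same operator are opposite by diagonalizability. The four mixed pairs share one
argument, in which `p` and `p'` record the order of the eigenspaces of `X` and `Y`. -/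
theorem IsSerrePair.tetFlag_opposite [IsAlgClosed K] [FiniteDimensional K V] {q : K}
    (hq : IsGeneric q) {d : ℕ} {X Y : Module.End K V} (h : IsSerrePair q d X Y)
    (hirr : JointlyIrreducible X Y) {i j : ZMod 4} (hij : i ≠ j) :
    OppositeFlags d (tetFlag q d X Y i) (tetFlag q d X Y j) := by
  have cross : ∀ p p' : K, (p = q ∨ p = q⁻¹) → (p' = q ∨ p' = q⁻¹) →
      OppositeFlags d (qFlag p d X) (qFlag p' d Y) := by
    intro p p' hp hp'
    have gp : IsGeneric p := by rcases hp with rfl | rfl; exacts [hq, hq.inv]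
    have gp' : IsGeneric p' := by rcases hp' with rfl | rfl; exacts [hq, hq.inv]
    have dX : QDiagonal p d X := by
      rcases hp with rfl | rfl; exacts [h.diag_left, h.diag_left.inv]
    have dY : QDiagonal p' d Y := by
      rcases hp' with rfl | rfl; exacts [h.diag_right, h.diag_right.inv]
    have sX : qSerre p X Y = 0 := by
      rcases hp with rfl | rfl
      exacts [h.serre_left, (qSerre_inv _ _ _).trans h.serre_left]
    have sY : qSerre p' Y X = 0 := by
      rcases hp' with rfl | rfl
      exacts [h.serre_right, (qSerre_inv _ _ _).trans h.serre_right]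
    exact hirr.opposite dX.isFlag dY.isFlag (qFlag_actsOn p d X) (dY.raises_of_qSerre gp' sY)
      (qFlag_actsOn p' d Y) (dX.raises_of_qSerre gp sX) (dX.bot_ne gp) (dX.ne_top gp)
  have h01 : OppositeFlags d (tetFlag q d X Y 0) (tetFlag q d X Y 1) := h.diag_left.opposite hq
  have h23 : OppositeFlags d (tetFlag q d X Y 2) (tetFlag q d X Y 3) := h.diag_right.opposite hq
  have h02 : OppositeFlags d (tetFlag q d X Y 0) (tetFlag q d X Y 2) :=
    cross q q (.inl rfl) (.inl rfl)
  have h03 : OppositeFlags d (tetFlag q d X Y 0) (tetFlag q d X Y 3) :=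
    cross q q⁻¹ (.inl rfl) (.inr rfl)
  have h12 : OppositeFlags d (tetFlag q d X Y 1) (tetFlag q d X Y 2) :=
    cross q⁻¹ q (.inr rfl) (.inl rfl)
  have h13 : OppositeFlags d (tetFlag q d X Y 1) (tetFlag q d X Y 3) :=
    cross q⁻¹ q⁻¹ (.inr rfl) (.inr rfl)
  exact ZMod.forall_four
    (P := fun i => ∀ j, i ≠ j → OppositeFlags d (tetFlag q d X Y i) (tetFlag q d X Y j))
    (ZMod.forall_four (fun h => absurd rfl h) (fun _ => h01) (fun _ => h02) fun _ => h03)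
    (ZMod.forall_four (fun _ => h01.symm) (fun h => absurd rfl h) (fun _ => h12) fun _ => h13)
    (ZMod.forall_four (fun _ => h02.symm) (fun _ => h12.symm) (fun h => absurd rfl h) fun _ => h23)
    (ZMod.forall_four (fun _ => h03.symm) (fun _ => h13.symm) (fun _ => h23.symm)
      fun h => absurd rfl h) i j hij

/-! ### The tetrahedron relations for the operators of the flags -/

/-- The defining relations of the `q`-tetrahedron algebra, for a family in any algebra. -/
structure TetRelations (q : K) {A : Type*} [Ring A] [Algebra K A] (E : ZMod 4 → ZMod 4 → A) :
    Prop where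
  inv : ∀ i j, j - i = 2 → E i j * E j i = 1
  weyl : ∀ h i j, ((i - h, j - i) = (1, 1) ∨ (i - h, j - i) = (1, 2) ∨ (i - h, j - i) = (2, 1)) →
    QWeyl q (E h i) (E i j)
  serre : ∀ h i j k, i - h = 1 → j - i = 1 → k - j = 1 → qSerre q (E h i) (E j k) = 0

theorem ZMod.forall_tetFaces {P : ZMod 4 → ZMod 4 → ZMod 4 → Prop}
    (h012 : P 0 1 2) (h123 : P 1 2 3) (h230 : P 2 3 0) (h301 : P 3 0 1)
    (h013 : P 0 1 3) (h120 : P 1 2 0) (h231 : P 2 3 1) (h302 : P 3 0 2)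
    (h023 : P 0 2 3) (h130 : P 1 3 0) (h201 : P 2 0 1) (h312 : P 3 1 2) (h i j : ZMod 4)
    (hc : (i - h, j - i) = (1, 1) ∨ (i - h, j - i) = (1, 2) ∨ (i - h, j - i) = (2, 1)) :
    P h i j := by
  revert h i j
  refine ZMod.forall_four ?_ ?_ ?_ ?_ <;> refine ZMod.forall_four ?_ ?_ ?_ ?_ <;>
    refine ZMod.forall_four ?_ ?_ ?_ ?_ <;> intro hc <;>
    first | assumption | exact absurd hc (by decide)

theorem ZMod.forall_tetCycles {P : ZMod 4 → ZMod 4 → ZMod 4 → ZMod 4 → Prop}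
    (h0 : P 0 1 2 3) (h1 : P 1 2 3 0) (h2 : P 2 3 0 1) (h3 : P 3 0 1 2) (h i j k : ZMod 4)
    (e1 : i - h = 1) (e2 : j - i = 1) (e3 : k - j = 1) : P h i j k := by
  rw [sub_eq_iff_eq_add] at e1 e2 e3
  subst e1 e2 e3
  revert h
  exact ZMod.forall_four h0 h1 h2 h3

theorem IsSerrePair.exists_tetRelations [IsAlgClosed K] [FiniteDimensional K V] {q : K}
    (hq : IsGeneric q) {d : ℕ} {X Y : Module.End K V} (h : IsSerrePair q d X Y)
    (hirr : JointlyIrreducible X Y) :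
    ∃ E : ZMod 4 → ZMod 4 → Module.End K V, TetRelations q E ∧ E 0 1 = X ∧ E 2 3 = Y := by
  have hopp : ∀ {i j : ZMod 4}, i ≠ j → OppositeFlags d (tetFlag q d X Y i) (tetFlag q d X Y j) :=
    h.tetFlag_opposite hq hirr
  have hex : ∀ i j : ZMod 4, ∃ E : Module.End K V, i ≠ j →
      ActsOn q d E (tetFlag q d X Y i) ∧ ActsOn q⁻¹ d E (tetFlag q d X Y j) := by
    intro i j
    by_cases hij : i = j
    -- The value on the diagonal is arbitrary; it only makes the family total.
    · exact ⟨0, fun hne => absurd hij hne⟩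
    · obtain ⟨E, hE⟩ := (hopp hij).exists_actsOn q
      exact ⟨E, fun _ => hE⟩
  choose E hE using hex
  have hX : E 0 1 = X := (hopp (by decide : (0 : ZMod 4) ≠ 1)).unique (hE 0 1 (by decide)).1
    (hE 0 1 (by decide)).2 (qFlag_actsOn q d X) (qFlag_actsOn q⁻¹ d X)
  have hY : E 2 3 = Y := (hopp (by decide : (2 : ZMod 4) ≠ 3)).unique (hE 2 3 (by decide)).1
    (hE 2 3 (by decide)).2 (qFlag_actsOn q d Y) (qFlag_actsOn q⁻¹ d Y)
  have Xr2 : Raises X (tetFlag q d X Y 2) := h.diag_right.raises_of_qSerre hq h.serre_right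
  have Xr3 : Raises X (tetFlag q d X Y 3) :=
    h.diag_right.inv.raises_of_qSerre hq.inv ((qSerre_inv _ _ _).trans h.serre_right)
  have Yr0 : Raises Y (tetFlag q d X Y 0) := h.diag_left.raises_of_qSerre hq h.serre_left
  have Yr1 : Raises Y (tetFlag q d X Y 1) :=
    h.diag_left.inv.raises_of_qSerre hq.inv ((qSerre_inv _ _ _).trans h.serre_left)
  have first : ∀ {i j k : ZMod 4}, k ≠ i → i ≠ j → Raises (E k i) (tetFlag q d X Y j) →
      QWeyl q (E k i) (E i j) := fun hki hij hr =>
    (hopp hij).qWeyl hq (hE _ _ hij).1 (hE _ _ hij).2 (hE _ _ hki).2 hr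
  -- This is the argument of `first` for the reversed edge, with `q⁻¹` in place of `q`.
  have second : ∀ {i j k : ZMod 4}, i ≠ j → j ≠ k → Raises (E j k) (tetFlag q d X Y i) →
      QWeyl q (E i j) (E j k) := fun hij hjk hr =>
    qWeyl_inv_iff.1 ((hopp hij.symm).qWeyl hq.inv (hE _ _ hij).2 (by simpa using (hE _ _ hij).1)
      (by simpa using (hE _ _ hjk).1) hr)
  have w012 : QWeyl q (E 0 1) (E 1 2) := first (by decide) (by decide) (by rwa [hX])
  have w013 : QWeyl q (E 0 1) (E 1 3) := first (by decide) (by decide) (by rwa [hX])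
  have w201 : QWeyl q (E 2 0) (E 0 1) := second (by decide) (by decide) (by rwa [hX])
  have w301 : QWeyl q (E 3 0) (E 0 1) := second (by decide) (by decide) (by rwa [hX])
  have w230 : QWeyl q (E 2 3) (E 3 0) := first (by decide) (by decide) (by rwa [hY])
  have w231 : QWeyl q (E 2 3) (E 3 1) := first (by decide) (by decide) (by rwa [hY])
  have w023 : QWeyl q (E 0 2) (E 2 3) := second (by decide) (by decide) (by rwa [hY])
  have w123 : QWeyl q (E 1 2) (E 2 3) := second (by decide) (by decide) (by rwa [hY])
  -- Every face contains exactly one of the edges 01 and 23. Two of its three relations involve that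
  -- edge and are settled above; `third` and `third'` treat the remaining one.
  have third : ∀ {i : ZMod 4}, i ≠ 0 → i ≠ 1 → QWeyl q (E 0 1) (E 1 i) →
      QWeyl q (E i 0) (E 0 1) → QWeyl q (E 1 i) (E i 0) := fun h0 h1 hw hw' =>
    qWeyl_of_qWeyl_of_qWeyl hq (hopp h0) (hX ▸ hw) (hX ▸ hw') (hE _ _ h1.symm).2 (hE _ _ h0).1
  have third' : ∀ {i : ZMod 4}, i ≠ 2 → i ≠ 3 → QWeyl q (E 2 3) (E 3 i) →
      QWeyl q (E i 2) (E 2 3) → QWeyl q (E 3 i) (E i 2) := fun h0 h1 hw hw' =>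
    qWeyl_of_qWeyl_of_qWeyl hq (hopp h0) (hY ▸ hw) (hY ▸ hw') (hE _ _ h1.symm).2 (hE _ _ h0).1
  have w120 := third (i := 2) (by decide) (by decide) w012 w201
  have w130 := third (i := 3) (by decide) (by decide) w013 w301
  have w302 := third' (i := 0) (by decide) (by decide) w230 w023
  have w312 := third' (i := 1) (by decide) (by decide) w231 w123
  -- The q-Serre relations between `E 1 2` and `E 3 0` need each of the two to raise both flags of
  -- the other.
  have r30 : Raises (E 3 0) (tetFlag q d X Y 1) ∧ Raises (E 3 0) (tetFlag q d X Y 2) :=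
    ⟨QWeyl.raises hq.inv (hX ▸ w301.inv), QWeyl.raises hq (hY ▸ w230)⟩
  have r12 : Raises (E 1 2) (tetFlag q d X Y 3) ∧ Raises (E 1 2) (tetFlag q d X Y 0) :=
    ⟨QWeyl.raises hq.inv (hY ▸ w123.inv), QWeyl.raises hq (hX ▸ w012)⟩
  refine ⟨E, ⟨fun i j hij => ?_, fun k i j hkij => ?_, fun a b c e h1 h2 h3 => ?_⟩, hX, hY⟩
  · have hne : i ≠ j := by
      rintro rfl
      rw [sub_self] at hij
      exact absurd hij (by decide)
    refine (hopp hne).ext fun t v hv hv' => ?_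
    rw [Module.End.mul_apply, (hopp hne.symm).apply_eq (hE j i hne.symm).1 (hE j i hne.symm).2 hv'
      (by rwa [sub_sub_cancel]), map_smul, (hopp hne).apply_eq (hE i j hne).1 (hE i j hne).2 hv hv',
      ← inv_zpow_sub q d t, inv_zpow, smul_smul, mul_inv_cancel₀ (zpow_ne_zero _ hq.ne_zero),
      one_smul, Module.End.one_apply]
  · exact ZMod.forall_tetFaces (P := fun k i j => QWeyl q (E k i) (E i j)) w012 w123 w230 w301
      w013 w120 w231 w302 w023 w130 w201 w312 k i j hkij
  · refine ZMod.forall_tetCycles (P := fun a b c e => qSerre q (E a b) (E c e) = 0)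
      ?_ ?_ ?_ ?_ a b c e h1 h2 h3
    · rw [hX, hY, h.serre_left]
    · exact (hopp (by decide : (1 : ZMod 4) ≠ 2)).qSerre_eq_zero hq (hE _ _ (by decide)).1
        (hE _ _ (by decide)).2 r30.1 r30.2
    · rw [hX, hY, h.serre_right]
    · exact (hopp (by decide : (3 : ZMod 4) ≠ 0)).qSerre_eq_zero hq (hE _ _ (by decide)).1
        (hE _ _ (by decide)).2 r12.1 r12.2

end Tetrahedron
/-! ### Operators satisfying the tetrahedron relations -/

section TetRelations

variable {K : Type u} [Field K] {V : Type v} [AddCommGroup V] [Module K V]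

theorem ZMod.forall_tetEdges {P : ZMod 4 → ZMod 4 → Prop} (h01 : P 0 1) (h12 : P 1 2)
    (h23 : P 2 3) (h30 : P 3 0) (h02 : P 0 2) (h20 : P 2 0) (h13 : P 1 3) (h31 : P 3 1)
    (i j : ZMod 4) (h : TetEdge i j) : P i j := by
  revert i j
  refine ZMod.forall_four ?_ ?_ ?_ ?_ <;> refine ZMod.forall_four ?_ ?_ ?_ ?_ <;> intro h <;>
    first | assumption | exact absurd h (by decide)

theorem TetEdge.ne {i j : ZMod 4} (h : TetEdge i j) : i ≠ j := by
  rintro rfl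
  rw [TetEdge, sub_self] at h
  exact absurd h (by decide)

theorem TetRelations.isSerrePair {q : K} {d : ℕ} {E : ZMod 4 → ZMod 4 → Module.End K V}
    (hE : TetRelations q E) (hX : QDiagonal q d (E 0 1)) (hY : QDiagonal q d (E 2 3)) :
    IsSerrePair q d (E 0 1) (E 2 3) :=
  ⟨hX, hY, hE.serre 0 1 2 3 (by decide) (by decide) (by decide),
    hE.serre 2 3 0 1 (by decide) (by decide) (by decide)⟩

/-- For 12 and 30 the q-Weyl relations with `x₀₁` and `x₂₃` cover both ends. For a diagonal they
cover one end only; the other comes from the reversed diagonal, which is its inverse. Irreducibility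
plays no role. -/
theorem TetRelations.actsOn {q : K} (hq : IsGeneric q) {d : ℕ}
    {E : ZMod 4 → ZMod 4 → Module.End K V} (hE : TetRelations q E) (hX : QDiagonal q d (E 0 1))
    (hY : QDiagonal q d (E 2 3)) (i j : ZMod 4) (hij : TetEdge i j) :
    ActsOn q d (E i j) (tetFlag q d (E 0 1) (E 2 3) i) ∧
      ActsOn q⁻¹ d (E i j) (tetFlag q d (E 0 1) (E 2 3) j) := by
  have i02 : E 0 2 * E 2 0 = 1 := hE.inv 0 2 (by decide)
  have i20 : E 2 0 * E 0 2 = 1 := hE.inv 2 0 (by decide)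
  have i13 : E 1 3 * E 3 1 = 1 := hE.inv 1 3 (by decide)
  have i31 : E 3 1 * E 1 3 = 1 := hE.inv 3 1 (by decide)
  have a12 : ActsOn q d (E 1 2) (tetFlag q d (E 0 1) (E 2 3) 1) :=
    (hE.weyl 0 1 2 (by decide)).actsOn hq hX.inv
  have a13 : ActsOn q d (E 1 3) (tetFlag q d (E 0 1) (E 2 3) 1) :=
    (hE.weyl 0 1 3 (by decide)).actsOn hq hX.inv
  have a30 : ActsOn q d (E 3 0) (tetFlag q d (E 0 1) (E 2 3) 3) :=
    (hE.weyl 2 3 0 (by decide)).actsOn hq hY.inv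
  have a31 : ActsOn q d (E 3 1) (tetFlag q d (E 0 1) (E 2 3) 3) :=
    (hE.weyl 2 3 1 (by decide)).actsOn hq hY.inv
  have into : ∀ {A B : Module.End K V}, QDiagonal q d B → QWeyl q A B →
      ActsOn q⁻¹ d A (qFlag q d B) := fun hB h => by
    have := h.inv.actsOn hq.inv (d := d) (by rwa [inv_inv])
    rwa [inv_inv] at this
  have b30 : ActsOn q⁻¹ d (E 3 0) (tetFlag q d (E 0 1) (E 2 3) 0) :=
    into hX (hE.weyl 3 0 1 (by decide))
  have b20 : ActsOn q⁻¹ d (E 2 0) (tetFlag q d (E 0 1) (E 2 3) 0) :=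
    into hX (hE.weyl 2 0 1 (by decide))
  have b12 : ActsOn q⁻¹ d (E 1 2) (tetFlag q d (E 0 1) (E 2 3) 2) :=
    into hY (hE.weyl 1 2 3 (by decide))
  have b02 : ActsOn q⁻¹ d (E 0 2) (tetFlag q d (E 0 1) (E 2 3) 2) :=
    into hY (hE.weyl 0 2 3 (by decide))
  have b13 : ActsOn q⁻¹ d (E 1 3) (tetFlag q d (E 0 1) (E 2 3) 3) :=
    a31.inv hq.ne_zero hY.inv.isFlag i13
  have b31 : ActsOn q⁻¹ d (E 3 1) (tetFlag q d (E 0 1) (E 2 3) 1) :=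
    a13.inv hq.ne_zero hX.inv.isFlag i31
  have a02 : ActsOn q d (E 0 2) (tetFlag q d (E 0 1) (E 2 3) 0) := by
    have := b20.inv hq.inv.ne_zero hX.isFlag i02
    rwa [inv_inv] at this
  have a20 : ActsOn q d (E 2 0) (tetFlag q d (E 0 1) (E 2 3) 2) := by
    have := b02.inv hq.inv.ne_zero hY.isFlag i20
    rwa [inv_inv] at this
  exact ZMod.forall_tetEdges (P := fun i j => ActsOn q d (E i j) (tetFlag q d (E 0 1) (E 2 3) i) ∧
      ActsOn q⁻¹ d (E i j) (tetFlag q d (E 0 1) (E 2 3) j))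
    ⟨qFlag_actsOn q d _, qFlag_actsOn q⁻¹ d _⟩ ⟨a12, b12⟩
    ⟨qFlag_actsOn q d _, qFlag_actsOn q⁻¹ d _⟩ ⟨a30, b30⟩ ⟨a02, b02⟩ ⟨a20, b20⟩ ⟨a13, b13⟩
    ⟨a31, b31⟩ i j hij

theorem tetFlag_isFlag {q : K} {d : ℕ} {X Y : Module.End K V} (hX : QDiagonal q d X)
    (hY : QDiagonal q d Y) : ∀ i, IsFlag d (tetFlag q d X Y i) :=
  ZMod.forall_four hX.isFlag hX.inv.isFlag hY.isFlag hY.inv.isFlag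

theorem tetFlag_strict {q : K} (hq : IsGeneric q) {d : ℕ} {X Y : Module.End K V}
    (hX : QDiagonal q d X) (hY : QDiagonal q d Y) :
    ∀ i, ∀ t : ℤ, 0 ≤ t → t ≤ d → tetFlag q d X Y i (t - 1) ≠ tetFlag q d X Y i t :=
  ZMod.forall_four (hX.strict hq) (hX.inv.strict hq.inv) (hY.strict hq) (hY.inv.strict hq.inv)

/-! ### Irreducibility under `x₀₁` and `x₂₃` alone -/

/-- An `X`-invariant subspace that avoids a low member of one flag of `X` lies in the
complementary member of the other flag. -/
theorem QDiagonal.le_qFlag_inv [FiniteDimensional K V] {p : K} {d : ℕ} {X : Module.End K V}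
    (h : QDiagonal p d X) {W : Submodule K V} (hW : ∀ v ∈ W, X v ∈ W) {k : ℤ}
    (hk : W ⊓ qFlag p d X k = ⊥) : W ≤ qFlag p⁻¹ d X (d - 1 - k) := by
  have htop : ⨆ μ, X.eigenspace μ = ⊤ := by
    rw [eq_top_iff, ← h.sup]
    exact iSup_le fun n => le_iSup X.eigenspace _
  rw [Submodule.eq_iSup_inf_genEigenspace 1 hW htop]
  refine iSup_le fun μ v hv => ?_
  by_cases h0 : v = 0
  · rw [h0]
    exact Submodule.zero_mem _
  have hv' : v ∈ qFlag p d X d := by rw [h.isFlag.top d le_rfl]; trivial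
  obtain ⟨n, hn0, hnd, rfl⟩ := (qFlag_actsOn p d X).eigenvalue h.isFlag.bot hv' h0
    (Module.End.mem_eigenspace_iff.1 hv.2)
  have hnk : k < n := by
    by_contra hle
    have : v ∈ W ⊓ qFlag p d X k := ⟨hv.1, eigenspace_le_qFlag hn0 (not_lt.1 hle) hv.2⟩
    rw [hk, Submodule.mem_bot] at this
    exact h0 this
  have hle := h.inv.eigenspace_le (n := (d : ℤ) - n) (k := d - 1 - k) (by omega)
  rw [inv_zpow_sub] at hle
  exact hle hv.2

/-- Here the flags are not known to span; the trivial intersection needed comes from the action of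
`E` itself. -/
theorem apply_eq_of_actsOn [IsAlgClosed K] [FiniteDimensional K V] {p : K} (hp : IsGeneric p)
    {d : ℕ} {E : Module.End K V} {F G : ℤ → Submodule K V} (hF : IsFlag d F) (hG : IsFlag d G)
    (hEF : ActsOn p d E F) (hEG : ActsOn p⁻¹ d E G) {t : ℤ} {v : V} (h1 : v ∈ F t)
    (h2 : v ∈ G (d - t)) : E v = p ^ ((d : ℤ) - 2 * t) • v := by
  have h2' := hEG _ v h2
  rw [inv_zpow_sub, sub_right_comm] at h2'
  have : E v - p ^ ((d : ℤ) - 2 * t) • v ∈ F t ⊓ G (d - 1 - t) :=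
    ⟨hF.mem_of_le (by omega) (hEF t v h1), h2'⟩
  rwa [disj_of_actsOn hp hF hG hEF hEG, Submodule.mem_bot, sub_eq_zero] at this

theorem TetRelations.invariant_of_minimal [IsAlgClosed K] [FiniteDimensional K V] {q : K}
    (hq : IsGeneric q) {d : ℕ} {E : ZMod 4 → ZMod 4 → Module.End K V} (hE : TetRelations q E)
    (hX : QDiagonal q d (E 0 1)) (hY : QDiagonal q d (E 2 3)) {W : Submodule K V} (hW0 : W ≠ ⊥)
    (hWX : ∀ v ∈ W, E 0 1 v ∈ W) (hWY : ∀ v ∈ W, E 2 3 v ∈ W)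
    (hmin : ∀ W' ≤ W, (∀ v ∈ W', E 0 1 v ∈ W') → (∀ v ∈ W', E 2 3 v ∈ W') → W' = ⊥ ∨ W' = W)
    (i j : ZMod 4) (hij : TetEdge i j) : ∀ v ∈ W, E i j v ∈ W := by
  have hS := hE.isSerrePair hX hY
  have hact := hE.actsOn hq hX hY
  have hflag := tetFlag_isFlag hX hY
  have Xr2 : Raises (E 0 1) (tetFlag q d (E 0 1) (E 2 3) 2) :=
    hY.raises_of_qSerre hq hS.serre_right
  have Xr3 : Raises (E 0 1) (tetFlag q d (E 0 1) (E 2 3) 3) :=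
    hY.inv.raises_of_qSerre hq.inv ((qSerre_inv _ _ _).trans hS.serre_right)
  have Yr0 : Raises (E 2 3) (tetFlag q d (E 0 1) (E 2 3) 0) :=
    hX.raises_of_qSerre hq hS.serre_left
  have Yr1 : Raises (E 2 3) (tetFlag q d (E 0 1) (E 2 3) 1) :=
    hX.inv.raises_of_qSerre hq.inv ((qSerre_inv _ _ _).trans hS.serre_left)
  have c0 : ∀ k, W ⊓ tetFlag q d (E 0 1) (E 2 3) 0 k = ⊥ →
      W ≤ tetFlag q d (E 0 1) (E 2 3) 1 (d - 1 - k) := fun k => hX.le_qFlag_inv hWX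
  have c1 : ∀ k, W ⊓ tetFlag q d (E 0 1) (E 2 3) 1 k = ⊥ →
      W ≤ tetFlag q d (E 0 1) (E 2 3) 0 (d - 1 - k) := fun k hk => by
    have := hX.inv.le_qFlag_inv hWX hk
    rwa [inv_inv] at this
  have c2 : ∀ k, W ⊓ tetFlag q d (E 0 1) (E 2 3) 2 k = ⊥ →
      W ≤ tetFlag q d (E 0 1) (E 2 3) 3 (d - 1 - k) := fun k => hY.le_qFlag_inv hWY
  have c3 : ∀ k, W ⊓ tetFlag q d (E 0 1) (E 2 3) 3 k = ⊥ →
      W ≤ tetFlag q d (E 0 1) (E 2 3) 2 (d - 1 - k) := fun k hk => by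
    have := hY.inv.le_qFlag_inv hWY hk
    rwa [inv_inv] at this
  have a0 := (hact 0 1 (by decide)).1
  have a1 := (hact 0 1 (by decide)).2
  have a2 := (hact 2 3 (by decide)).1
  have a3 := (hact 2 3 (by decide)).2
  generalize tetFlag q d (E 0 1) (E 2 3) = F at *
  have disj : ∀ {i j : ZMod 4}, TetEdge i j → ∀ t : ℤ, F i t ⊓ F j (d - 1 - t) = ⊥ :=
    fun h => disj_of_actsOn hq (hflag _) (hflag _) (hact _ _ h).1 (hact _ _ h).2
  have disj' : ∀ {i j : ZMod 4}, TetEdge j i → ∀ t : ℤ, F i t ⊓ F j (d - 1 - t) = ⊥ :=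
    fun {i j} h t => by
      have := disj h (d - 1 - t)
      rwa [sub_sub_cancel, inf_comm] at this
  -- If `W` misses `F j k`, it lies in the complementary level of the other flag `j'` of the same
  -- operator, which is disjoint from `F i k`. Going round the tetrahedron, `W` meets all four flags
  -- from the same index on.
  have step : ∀ {i j j' : ZMod 4}, (∀ k, W ⊓ F j k = ⊥ → W ≤ F j' (d - 1 - k)) →
      (∀ t : ℤ, F i t ⊓ F j' (d - 1 - t) = ⊥) → ∀ {k}, W ⊓ F j k = ⊥ → W ⊓ F i k = ⊥ := by
    intro i j j' hc hd k hk
    rw [eq_bot_iff, ← hd k]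
    exact le_inf inf_le_right (inf_le_left.trans (hc k hk))
  have s20 : ∀ {k}, W ⊓ F 2 k = ⊥ → W ⊓ F 0 k = ⊥ := step c2 (disj' (by decide))
  have s02 : ∀ {k}, W ⊓ F 0 k = ⊥ → W ⊓ F 2 k = ⊥ := step c0 (disj' (by decide))
  have s30 : ∀ {k}, W ⊓ F 3 k = ⊥ → W ⊓ F 0 k = ⊥ := step c3 (disj (by decide))
  have s03 : ∀ {k}, W ⊓ F 0 k = ⊥ → W ⊓ F 3 k = ⊥ := step c0 (disj (by decide))
  have s12 : ∀ {k}, W ⊓ F 1 k = ⊥ → W ⊓ F 2 k = ⊥ := step c1 (disj (by decide))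
  have s21 : ∀ {k}, W ⊓ F 2 k = ⊥ → W ⊓ F 1 k = ⊥ := step c2 (disj (by decide))
  have all : ∀ i k, W ⊓ F i k = ⊥ ↔ W ⊓ F 0 k = ⊥ :=
    ZMod.forall_four (fun _ => Iff.rfl) (fun k => ⟨fun h => s20 (s12 h), fun h => s21 (s02 h)⟩)
      (fun k => ⟨s20, s02⟩) (fun k => ⟨s30, s03⟩)
  obtain ⟨k, hk, hkmin⟩ := Int.exists_least_of_bdd (P := fun k => W ⊓ F 0 k ≠ ⊥)
    ⟨0, fun z hz => by
      by_contra hneg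
      exact hz (by rw [(hflag 0).bot z (by omega), inf_bot_eq])⟩
    ⟨d, by rwa [(hflag 0).top d le_rfl, inf_top_eq]⟩
  have hk1 : W ⊓ F 0 (k - 1) = ⊥ := by
    by_contra hne
    have := hkmin _ hne
    omega
  have hsum : ∀ {i j j' : ZMod 4} {p p' : K}, ActsOn p d (E 0 1) (F i) → Raises (E 0 1) (F j) →
      ActsOn p' d (E 2 3) (F j) → Raises (E 2 3) (F i) →
      (∀ k, W ⊓ F j' k = ⊥ → W ≤ F j (d - 1 - k)) →
      ⨆ t : ℤ, W ⊓ (F i t ⊓ F j (d - t)) = W := by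
    intro i j j' p p' h1 h2 h3 h4 h5
    refine (hmin _ (iSup_le fun t => inf_le_left)
      (fun v hv => iSup_inf_invariant_left hWX h1 (hflag j).mono h2 d hv)
      (fun v hv => iSup_inf_invariant_right hWY h3 (hflag i).mono h4 d hv)).resolve_left ?_
    intro hbot
    have hi : W ⊓ F i k ≠ ⊥ := fun h => hk ((all i k).1 h)
    -- `W` misses level `k - 1` of flag `j'`, so it lies in `F j (d - k)`. Since `W` meets `F i k`,
    -- the term `t = k` of the sum is nonzero.
    have hj := h5 _ ((all j' (k - 1)).2 hk1)
    rw [sub_sub, add_sub_cancel] at hj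
    refine hi (eq_bot_iff.2 ?_)
    rw [← hbot]
    refine le_trans ?_ (le_iSup (fun t : ℤ => W ⊓ (F i t ⊓ F j (d - t))) k)
    exact le_inf inf_le_left (le_inf inf_le_right (inf_le_left.trans hj))
  have e02 := hsum a0 Xr2 a2 Yr0 c3
  have e03 := hsum a0 Xr3 a3 Yr0 c2
  have e12 := hsum a1 Xr2 a2 Yr1 c3
  have e13 := hsum a1 Xr3 a3 Yr1 c2
  have fin : ∀ {i j : ZMod 4}, TetEdge i j → ⨆ t : ℤ, W ⊓ (F i t ⊓ F j (d - t)) = W →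
      ∀ v ∈ W, E i j v ∈ W := by
    intro i j hij he
    suffices H : ⨆ t : ℤ, W ⊓ (F i t ⊓ F j (d - t)) ≤ W.comap (E i j) by
      rw [he] at H
      exact H
    refine iSup_le fun t v hv => ?_
    rw [Submodule.mem_comap, apply_eq_of_actsOn hq (hflag i) (hflag j) (hact i j hij).1
      (hact i j hij).2 hv.2.1 hv.2.2]
    exact W.smul_mem _ hv.1
  exact ZMod.forall_tetEdges (P := fun i j => ∀ v ∈ W, E i j v ∈ W) hWX
    (fin (by decide) e12) hWY (fin (by decide) ((iSup_inf_comm _ _ _ _).trans e03))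
    (fin (by decide) e02) (fin (by decide) ((iSup_inf_comm _ _ _ _).trans e02))
    (fin (by decide) e13) (fin (by decide) ((iSup_inf_comm _ _ _ _).trans e13)) i j hij

/-- By finite dimension an invariant subspace contains a minimal nonzero one; that one is stable
under all generators, hence is the whole space. -/
theorem TetRelations.jointlyIrreducible [IsAlgClosed K] [FiniteDimensional K V] {q : K}
    (hq : IsGeneric q) {d : ℕ} {E : ZMod 4 → ZMod 4 → Module.End K V} (hE : TetRelations q E)
    (hX : QDiagonal q d (E 0 1)) (hY : QDiagonal q d (E 2 3))
    (hirr : ∀ W : Submodule K V, (∀ i j, TetEdge i j → ∀ v ∈ W, E i j v ∈ W) → W = ⊥ ∨ W = ⊤) :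
    JointlyIrreducible (E 0 1) (E 2 3) := by
  intro W₀ hX₀ hY₀
  rw [or_iff_not_imp_left]
  intro hne
  obtain ⟨W, ⟨hle, hW0, hWX, hWY⟩, hmin⟩ := (wellFounded_lt (α := Submodule K V)).has_min
    {W | W ≤ W₀ ∧ W ≠ ⊥ ∧ (∀ v ∈ W, E 0 1 v ∈ W) ∧ ∀ v ∈ W, E 2 3 v ∈ W}
    ⟨W₀, le_rfl, hne, hX₀, hY₀⟩
  have hinv := hE.invariant_of_minimal hq hX hY hW0 hWX hWY fun W' hW' h1 h2 => by
    by_cases hbot : W' = ⊥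
    · exact .inl hbot
    · exact .inr (hW'.eq_of_not_lt (hmin W' ⟨hW'.trans hle, hbot, h1, h2⟩))
  have htop := (hirr W hinv).resolve_left hW0
  rw [htop, top_le_iff] at hle
  exact hle

/-! ### Uniqueness, semisimplicity and spectrum of the generators -/

theorem TetRelations.unique [IsAlgClosed K] [FiniteDimensional K V] {q : K}
    (hq : IsGeneric q) {d : ℕ} {E E' : ZMod 4 → ZMod 4 → Module.End K V} (hE : TetRelations q E)
    (hE' : TetRelations q E') (h01 : E' 0 1 = E 0 1) (h23 : E' 2 3 = E 2 3)
    (hX : QDiagonal q d (E 0 1)) (hY : QDiagonal q d (E 2 3))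
    (hirr : JointlyIrreducible (E 0 1) (E 2 3)) (i j : ZMod 4) (hij : TetEdge i j) :
    E' i j = E i j := by
  have h := hE.actsOn hq hX hY i j hij
  have h' := hE'.actsOn hq (h01 ▸ hX) (h23 ▸ hY) i j hij
  rw [h01, h23] at h'
  exact ((hE.isSerrePair hX hY).tetFlag_opposite hq hirr hij.ne).unique h'.1 h'.2 h.1 h.2

theorem TetRelations.isSemisimple [IsAlgClosed K] [FiniteDimensional K V] {q : K}
    (hq : IsGeneric q) {d : ℕ} {E : ZMod 4 → ZMod 4 → Module.End K V} (hE : TetRelations q E)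
    (hX : QDiagonal q d (E 0 1)) (hY : QDiagonal q d (E 2 3))
    (hirr : JointlyIrreducible (E 0 1) (E 2 3)) (i j : ZMod 4) (hij : TetEdge i j) :
    (E i j).IsSemisimple :=
  ((hE.isSerrePair hX hY).tetFlag_opposite hq hirr hij.ne).isSemisimple hq
    (hE.actsOn hq hX hY i j hij).1 (hE.actsOn hq hX hY i j hij).2

theorem TetRelations.hasEigenvalue_iff [IsAlgClosed K] [FiniteDimensional K V] {q : K}
    (hq : IsGeneric q) {d : ℕ} {E : ZMod 4 → ZMod 4 → Module.End K V} (hE : TetRelations q E)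
    (hX : QDiagonal q d (E 0 1)) (hY : QDiagonal q d (E 2 3))
    (hirr : JointlyIrreducible (E 0 1) (E 2 3)) (i j : ZMod 4) (hij : TetEdge i j) (μ : K) :
    (E i j).HasEigenvalue μ ↔ ∃ n : ℕ, n ≤ d ∧ μ = q ^ ((d : ℤ) - 2 * (n : ℤ)) :=
  ((hE.isSerrePair hX hY).tetFlag_opposite hq hirr hij.ne).hasEigenvalue_iff
    (tetFlag_strict hq hX hY i) (hE.actsOn hq hX hY i j hij).1 (hE.actsOn hq hX hY i j hij).2 μ

/-! ### Diagonalizability -/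

theorem QDiagonal.of_iSup_eq_top {q : K} (hq : IsGeneric q) {d : ℕ} {X : Module.End K V}
    (hspec : ∀ μ, X.HasEigenvalue μ ↔ ∃ n : ℕ, n ≤ d ∧ μ = q ^ ((d : ℤ) - 2 * (n : ℤ)))
    (hsup : ⨆ n : ℤ, X.eigenspace (q ^ ((d : ℤ) - 2 * n)) = ⊤) : QDiagonal q d X where
  sup := hsup
  bot n hn := by
    by_contra hne
    obtain ⟨m, hm, he⟩ := (hspec _).1 (Module.End.hasEigenvalue_iff.2 hne)
    have := hq.zpow_inj he
    omega
  ne_bot n hn0 hnd := by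
    lift n to ℕ using hn0
    exact Module.End.hasEigenvalue_iff.1 ((hspec _).2 ⟨n, by exact_mod_cast hnd, rfl⟩)

theorem QDiagonal.of_isSemisimple [IsAlgClosed K] [FiniteDimensional K V] {q : K}
    (hq : IsGeneric q) {d : ℕ} {X : Module.End K V}
    (hspec : ∀ μ, X.HasEigenvalue μ ↔ ∃ n : ℕ, n ≤ d ∧ μ = q ^ ((d : ℤ) - 2 * (n : ℤ)))
    (hss : X.IsSemisimple) : QDiagonal q d X := by
  refine .of_iSup_eq_top hq hspec (eq_top_iff.2 ?_)
  rw [← hss.iSup_eigenspace_eq_top]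
  refine iSup_le fun μ => ?_
  by_cases hμ : X.HasEigenvalue μ
  · obtain ⟨n, -, rfl⟩ := (hspec μ).1 hμ
    exact le_iSup (fun n : ℤ => X.eigenspace (q ^ ((d : ℤ) - 2 * n))) n
  · rw [Module.End.hasEigenvalue_iff, not_not] at hμ
    rw [hμ]
    exact bot_le

/-- Semisimplicity is not assumed: the span of the eigenspaces is stable under `Y` by
`mem_of_qSerre`, and nonzero since `q ^ d` is an eigenvalue. -/
theorem QDiagonal.of_jointlyIrreducible {q : K} (hq : IsGeneric q) {d : ℕ}
    {X Y : Module.End K V}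
    (hspec : ∀ μ, X.HasEigenvalue μ ↔ ∃ n : ℕ, n ≤ d ∧ μ = q ^ ((d : ℤ) - 2 * (n : ℤ)))
    (hXY : qSerre q X Y = 0) (hirr : JointlyIrreducible X Y) : QDiagonal q d X := by
  set S : Submodule K V := ⨆ n : ℤ, X.eigenspace (q ^ ((d : ℤ) - 2 * n)) with hS
  have hle : ∀ n : ℤ, X.eigenspace (q ^ ((d : ℤ) - 2 * n)) ≤ S :=
    le_iSup fun n : ℤ => X.eigenspace (q ^ ((d : ℤ) - 2 * n))
  refine .of_iSup_eq_top hq hspec ((hirr S ?_ ?_).resolve_left fun hbot => ?_)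
  · suffices H : S ≤ S.comap X from H
    refine iSup_le fun n v hv => ?_
    rw [Submodule.mem_comap, Module.End.mem_eigenspace_iff.1 hv]
    exact S.smul_mem _ (hle n hv)
  · suffices H : S ≤ S.comap Y from H
    exact iSup_le fun n v hv => mem_of_qSerre hq hXY hv (hle _) (hle _) (hle _)
  · have h0 := (hspec (q ^ ((d : ℤ) - 2 * ((0 : ℕ) : ℤ)))).2 ⟨0, Nat.zero_le d, rfl⟩
    exact Module.End.hasEigenvalue_iff.1 h0 (eq_bot_iff.2 (hbot ▸ hle _))

end TetRelations
/-! ### Modules over `A_q` and over the `q`-tetrahedron algebra -/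

section ModuleTheory

variable {K : Type u} [Field K] {q : K}

theorem RingQuot.freeAlgebra_induction {X : Type*} {r : FreeAlgebra K X → FreeAlgebra K X → Prop}
    {C : RingQuot r → Prop} (halg : ∀ k : K, C (algebraMap K _ k))
    (hgen : ∀ x, C (RingQuot.mkAlgHom K r (FreeAlgebra.ι K x)))
    (hmul : ∀ a b, C a → C b → C (a * b)) (hadd : ∀ a b, C a → C b → C (a + b))
    (a : RingQuot r) : C a := by
  obtain ⟨a, rfl⟩ := RingQuot.mkAlgHom_surjective K r a
  induction a using FreeAlgebra.induction with
  | grade0 k => rw [AlgHom.commutes]; exact halg k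
  | grade1 x => exact hgen x
  | mul a b ha hb => rw [map_mul]; exact hmul _ _ ha hb
  | add a b ha hb => rw [map_add]; exact hadd _ _ ha hb

theorem Aq.induction {C : Aq q → Prop} (halg : ∀ k : K, C (algebraMap K _ k))
    (hx : C (Aq.gen q AqGen.x)) (hy : C (Aq.gen q AqGen.y))
    (hmul : ∀ a b, C a → C b → C (a * b)) (hadd : ∀ a b, C a → C b → C (a + b))
    (a : Aq q) : C a :=
  RingQuot.freeAlgebra_induction halg (fun g => by cases g; exacts [hx, hy]) hmul hadd a

theorem Tet.induction {C : Tet q → Prop} (halg : ∀ k : K, C (algebraMap K _ k))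
    (hgen : ∀ i j h, C (Tet.gen q i j h))
    (hmul : ∀ a b, C a → C b → C (a * b)) (hadd : ∀ a b, C a → C b → C (a + b))
    (a : Tet q) : C a :=
  RingQuot.freeAlgebra_induction halg (fun g => hgen g.1.1 g.1.2 g.2) hmul hadd a

theorem TetRelations.map {A B : Type*} [Ring A] [Algebra K A] [Ring B] [Algebra K B]
    {E : ZMod 4 → ZMod 4 → A} (hE : TetRelations q E) (f : A →ₐ[K] B) :
    TetRelations q fun i j => f (E i j) where
  inv i j hij := by rw [← map_mul, hE.inv i j hij, map_one]
  weyl h i j hc := by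
    have := congrArg f (hE.weyl h i j hc)
    simp only [map_sub, map_smul, map_mul, map_one] at this
    exact this
  serre h i j k h1 h2 h3 := by rw [← map_qSerre, hE.serre h i j k h1 h2 h3, map_zero]

/-- The generators of the `q`-tetrahedron algebra as a family indexed by all pairs. -/
def Tet.genFun (q : K) (i j : ZMod 4) : Tet q :=
  -- The value off the edges is harmless, because the relations only involve edges.
  if h : TetEdge i j then Tet.gen q i j h else 0

theorem Tet.genFun_eq {i j : ZMod 4} (h : TetEdge i j) : Tet.genFun q i j = Tet.gen q i j h :=
  dif_pos h

theorem Tet.tetRelations_genFun (hq : IsGeneric q) : TetRelations q (Tet.genFun q) where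
  inv i j hij := by
    have hji : i - j = 2 := by
      rw [← neg_sub, hij]
      decide
    rw [Tet.genFun_eq (.inr hij), Tet.genFun_eq (.inr hji)]
    have := RingQuot.mkAlgHom_rel K (TetRel.inv (q := q) i j (.inr hij) (.inr hji) hij)
    rwa [map_mul, map_one] at this
  weyl h i j hc := by
    have hhi : TetEdge h i := by
      simp only [Prod.mk.injEq] at hc
      rcases hc with hc | hc | hc
      exacts [.inl hc.1, .inl hc.1, .inr hc.1]
    have hij : TetEdge i j := by
      simp only [Prod.mk.injEq] at hc
      rcases hc with hc | hc | hc
      exacts [.inl hc.2, .inr hc.2, .inl hc.2]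
    rw [Tet.genFun_eq hhi, Tet.genFun_eq hij]
    have := RingQuot.mkAlgHom_rel K (TetRel.weyl (q := q) h i j hhi hij hc)
    simp only [map_sub, map_smul, map_mul, map_one] at this
    rw [inv_smul_eq_iff₀ hq.sub_inv_ne_zero] at this
    exact this
  serre h i j k h1 h2 h3 := by
    rw [Tet.genFun_eq (.inl h1), Tet.genFun_eq (.inl h3)]
    exact Tet.qSerre_gen q h i j k _ _ h1 h2 h3

theorem TetRelations.exists_algHom (hq : IsGeneric q) {A : Type*} [Ring A] [Algebra K A]
    {E : ZMod 4 → ZMod 4 → A} (hE : TetRelations q E) :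
    ∃ φ : Tet q →ₐ[K] A, ∀ i j h, φ (Tet.gen q i j h) = E i j := by
  have hfree : ∀ i j h, FreeAlgebra.lift K (fun g : TetGen => E g.1.1 g.1.2) (freeTet K i j h) =
      E i j := fun i j h => FreeAlgebra.lift_ι_apply _ _
  refine ⟨RingQuot.liftAlgHom K ⟨FreeAlgebra.lift K fun g : TetGen => E g.1.1 g.1.2, ?_⟩,
    fun i j h => ?_⟩
  · rintro _ _ (⟨i, j, hij, hji, h2⟩ | ⟨h, i, j, hhi, hij, hc⟩ | ⟨h, i, j, k, hhi, hjk, h1, h2, h3⟩)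
    · rw [map_mul, map_one, hfree, hfree, hE.inv i j h2]
    · simp only [map_sub, map_smul, map_mul, map_one, hfree]
      rw [inv_smul_eq_iff₀ hq.sub_inv_ne_zero]
      exact hE.weyl h i j hc
    · rw [map_qSerre, map_zero, hfree, hfree, hE.serre h i j k h1 h2 h3]
  · rw [Tet.gen, RingQuot.liftAlgHom_mkAlgHom_apply]
    exact hfree i j h

theorem Aq.toTet_x : Aq.toTet q (Aq.gen q AqGen.x) = Tet.gen q 0 1 := by
  rw [Aq.toTet, Aq.gen, RingQuot.liftAlgHom_mkAlgHom_apply, FreeAlgebra.lift_ι_apply]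
  rfl

theorem Aq.toTet_y : Aq.toTet q (Aq.gen q AqGen.y) = Tet.gen q 2 3 := by
  rw [Aq.toTet, Aq.gen, RingQuot.liftAlgHom_mkAlgHom_apply, FreeAlgebra.lift_ι_apply]
  rfl

theorem Aq.qSerre_xy : qSerre q (Aq.gen q AqGen.x) (Aq.gen q AqGen.y) = 0 := by
  have := RingQuot.mkAlgHom_rel K (AqRel.serre_xy (q := q))
  rwa [map_qSerre, map_zero] at this

theorem Aq.qSerre_yx : qSerre q (Aq.gen q AqGen.y) (Aq.gen q AqGen.x) = 0 := by
  have := RingQuot.mkAlgHom_rel K (AqRel.serre_yx (q := q))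
  rwa [map_qSerre, map_zero] at this

/-- A module over a `K`-algebra has only one compatible `K`-module structure. -/
theorem module_eq_of_isScalarTower {A V : Type*} [Ring A] [Algebra K A] [AddCommGroup V]
    [Module A V] (m₁ m₂ : Module K V) (t₁ : letI := m₁; IsScalarTower K A V)
    (t₂ : letI := m₂; IsScalarTower K A V) : m₁ = m₂ := by
  refine Module.ext' _ _ fun k v => ?_
  have h1 := letI := m₁; algebraMap_smul A k v
  have h2 := letI := m₂; algebraMap_smul A k v
  exact h1.symm.trans h2

/-! ### From irreducible `A_q`-modules to q-Serre pairs -/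

section Aq

variable {V : Type v} [AddCommGroup V] [Module K V] [Module (Aq q) V] [IsScalarTower K (Aq q) V]

theorem Aq.smul_mem_of_gen {W : Submodule K V} (hx : ∀ v ∈ W, Aq.gen q AqGen.x • v ∈ W)
    (hy : ∀ v ∈ W, Aq.gen q AqGen.y • v ∈ W) (a : Aq q) : ∀ v ∈ W, a • v ∈ W := by
  induction a using Aq.induction with
  | halg k => intro v hv; rw [algebraMap_smul]; exact W.smul_mem k hv
  | hx => exact hx
  | hy => exact hy
  | hmul a b ha hb => intro v hv; rw [mul_smul]; exact ha _ (hb v hv)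
  | hadd a b ha hb => intro v hv; rw [add_smul]; exact W.add_mem (ha v hv) (hb v hv)

theorem Aq.jointlyIrreducible [IsSimpleModule (Aq q) V] :
    JointlyIrreducible (Algebra.lsmul K K V (Aq.gen q AqGen.x) : Module.End K V)
      (Algebra.lsmul K K V (Aq.gen q AqGen.y)) := by
  intro W hx hy
  let W' : Submodule (Aq q) V :=
    { W with smul_mem' := fun a v hv => Aq.smul_mem_of_gen hx hy a v hv }
  rcases eq_bot_or_eq_top W' with h | h
  · refine .inl ((Submodule.eq_bot_iff _).2 fun v hv => ?_)
    have : v ∈ W' := hv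
    rwa [h, Submodule.mem_bot] at this
  · refine .inr (Submodule.eq_top_iff'.2 fun v => ?_)
    have : v ∈ W' := h ▸ Submodule.mem_top
    exact this

theorem Aq.isSimpleModule [Nontrivial V]
    (h : JointlyIrreducible (Algebra.lsmul K K V (Aq.gen q AqGen.x) : Module.End K V)
      (Algebra.lsmul K K V (Aq.gen q AqGen.y))) : IsSimpleModule (Aq q) V := by
  refine (isSimpleModule_iff (Aq q) V).2 { eq_bot_or_eq_top := fun W => ?_ }
  rcases h (W.restrictScalars K) (fun v hv => W.smul_mem _ hv) (fun v hv => W.smul_mem _ hv)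
    with hW | hW
  · exact .inl ((Submodule.restrictScalars_eq_bot_iff K (Aq q) V).1 hW)
  · exact .inr ((Submodule.restrictScalars_eq_top_iff K (Aq q) V).1 hW)

theorem Aq.exists_isSerrePair (hq : IsGeneric q) [IsSimpleModule (Aq q) V]
    (ht : Aq.HasType q V 1 1) :
    ∃ d, IsSerrePair q d (Algebra.lsmul K K V (Aq.gen q AqGen.x) : Module.End K V)
      (Algebra.lsmul K K V (Aq.gen q AqGen.y)) := by
  obtain ⟨-, -, d, hx, hy⟩ := ht
  have hirr := Aq.jointlyIrreducible (q := q) (V := V)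
  have hxy : qSerre q (Algebra.lsmul K K V (Aq.gen q AqGen.x) : Module.End K V)
      (Algebra.lsmul K K V (Aq.gen q AqGen.y)) = 0 := by
    rw [← map_qSerre, Aq.qSerre_xy, map_zero]
  have hyx : qSerre q (Algebra.lsmul K K V (Aq.gen q AqGen.y) : Module.End K V)
      (Algebra.lsmul K K V (Aq.gen q AqGen.x)) = 0 := by
    rw [← map_qSerre, Aq.qSerre_yx, map_zero]
  refine ⟨d, .of_jointlyIrreducible hq (fun μ => ?_) hxy hirr,
    .of_jointlyIrreducible hq (fun μ => ?_) hyx fun W h1 h2 => hirr W h2 h1, hxy, hyx⟩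
  · simpa using Set.ext_iff.1 hx μ
  · simpa using Set.ext_iff.1 hy μ

end Aq

/-! ### The generators acting on a `⊠_q`-module -/

section Tet

variable {V : Type v} [AddCommGroup V] [Module K V] [Module (Tet q) V] [IsScalarTower K (Tet q) V]

variable (q V) in
/-- The action of the generators of the `q`-tetrahedron algebra on a module. -/
def Tet.action (i j : ZMod 4) : Module.End K V := Algebra.lsmul K K V (Tet.genFun q i j)

theorem Tet.action_eq {i j : ZMod 4} (h : TetEdge i j) :
    Tet.action q V i j = Algebra.lsmul K K V (Tet.gen q i j h) := by
  rw [Tet.action, Tet.genFun_eq h]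

theorem Tet.action_apply {i j : ZMod 4} (h : TetEdge i j) (v : V) :
    Tet.action q V i j v = Tet.gen q i j h • v := by
  rw [Tet.action_eq h]
  rfl

theorem Tet.tetRelations_action (hq : IsGeneric q) : TetRelations q (Tet.action q V) :=
  (Tet.tetRelations_genFun hq).map (Algebra.lsmul K K V)

theorem Tet.smul_mem_of_gen {W : Submodule K V}
    (hgen : ∀ i j, TetEdge i j → ∀ v ∈ W, Tet.action q V i j v ∈ W) (a : Tet q) :
    ∀ v ∈ W, a • v ∈ W := by
  induction a using Tet.induction with
  | halg k => intro v hv; rw [algebraMap_smul]; exact W.smul_mem k hv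
  | hgen i j h => intro v hv; rw [← Tet.action_apply]; exact hgen i j h v hv
  | hmul a b ha hb => intro v hv; rw [mul_smul]; exact ha _ (hb v hv)
  | hadd a b ha hb => intro v hv; rw [add_smul]; exact W.add_mem (ha v hv) (hb v hv)

theorem Tet.eq_bot_or_eq_top [IsSimpleModule (Tet q) V] (W : Submodule K V)
    (hgen : ∀ i j, TetEdge i j → ∀ v ∈ W, Tet.action q V i j v ∈ W) : W = ⊥ ∨ W = ⊤ := by
  let W' : Submodule (Tet q) V :=
    { W with smul_mem' := fun a v hv => Tet.smul_mem_of_gen hgen a v hv }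
  rcases IsSimpleOrder.eq_bot_or_eq_top W' with h | h
  · refine .inl ((Submodule.eq_bot_iff _).2 fun v hv => ?_)
    have : v ∈ W' := hv
    rwa [h, Submodule.mem_bot] at this
  · refine .inr (Submodule.eq_top_iff'.2 fun v => ?_)
    have : v ∈ W' := h ▸ Submodule.mem_top
    exact this

theorem Tet.HasType.spectrum (ht : Tet.HasType q V 1) : ∃ d : ℕ, ∀ i j, TetEdge i j →
    (Tet.action q V i j).IsSemisimple ∧ ∀ μ, (Tet.action q V i j).HasEigenvalue μ ↔
      ∃ n : ℕ, n ≤ d ∧ μ = q ^ ((d : ℤ) - 2 * (n : ℤ)) := by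
  obtain ⟨-, d, hd⟩ := ht
  refine ⟨d, fun i j h => ?_⟩
  rw [Tet.action_eq h]
  exact ⟨(hd i j h).1, fun μ => by simpa using Set.ext_iff.1 (hd i j h).2 μ⟩

theorem Tet.HasType.exists_diagonal [IsAlgClosed K] [FiniteDimensional K V] (hq : IsGeneric q)
    [IsSimpleModule (Tet q) V] (ht : Tet.HasType q V 1) :
    ∃ d : ℕ, QDiagonal q d (Tet.action q V 0 1) ∧ QDiagonal q d (Tet.action q V 2 3) ∧
      JointlyIrreducible (Tet.action q V 0 1) (Tet.action q V 2 3) := by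
  obtain ⟨d, hd⟩ := ht.spectrum
  have hX : QDiagonal q d (Tet.action q V 0 1) :=
    .of_isSemisimple hq (hd 0 1 (by decide)).2 (hd 0 1 (by decide)).1
  have hY : QDiagonal q d (Tet.action q V 2 3) :=
    .of_isSemisimple hq (hd 2 3 (by decide)).2 (hd 2 3 (by decide)).1
  exact ⟨d, hX, hY, (Tet.tetRelations_action hq).jointlyIrreducible hq hX hY Tet.eq_bot_or_eq_top⟩

/-- A map between irreducible modules of type `1` that commutes with `x₀₁` and `x₂₃` is linear
over the `q`-tetrahedron algebra. -/
theorem Tet.map_smul_of_gen [IsAlgClosed K] [FiniteDimensional K V] (hq : IsGeneric q)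
    [IsSimpleModule (Tet q) V] (ht : Tet.HasType q V 1) {V' : Type v} [AddCommGroup V']
    [Module K V'] [Module (Tet q) V'] [IsScalarTower K (Tet q) V'] (e : V ≃ₗ[K] V')
    (h01 : ∀ v, e (Tet.action q V 0 1 v) = Tet.action q V' 0 1 (e v))
    (h23 : ∀ v, e (Tet.action q V 2 3 v) = Tet.action q V' 2 3 (e v)) (a : Tet q) :
    ∀ v, e (a • v) = a • e v := by
  obtain ⟨d, hX, hY, hirr⟩ := ht.exists_diagonal hq
  -- The action on `V'` is conjugated by `e` to a second family on `V`, so that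
  -- `TetRelations.unique` compares the two.
  have hE' := (Tet.tetRelations_action (V := V') hq).map (e.symm.conjAlgEquiv K).toAlgHom
  have hconj : ∀ (f : Module.End K V') (v : V),
      (e.symm.conjAlgEquiv K).toAlgHom f v = e.symm (f (e v)) := fun f v => rfl
  have hu := (Tet.tetRelations_action (V := V) hq).unique hq hE'
    (LinearMap.ext fun v => by rw [hconj, ← h01, e.symm_apply_apply])
    (LinearMap.ext fun v => by rw [hconj, ← h23, e.symm_apply_apply]) hX hY hirr
  induction a using Tet.induction with
  | halg k => intro v; rw [algebraMap_smul, algebraMap_smul, map_smul]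
  | hgen i j h =>
    intro v
    have := congrArg (fun f : Module.End K V => e (f v)) (hu i j h)
    simp only [hconj, e.apply_symm_apply] at this
    rw [← Tet.action_apply, ← Tet.action_apply, this]
  | hmul a b ha hb => intro v; rw [mul_smul, mul_smul, ha, hb]
  | hadd a b ha hb => intro v; rw [add_smul, add_smul, map_add, ha, hb]

end Tet

/-! ### Compatible actions of `A_q` and `⊠_q` on one space -/

section Both

variable {V : Type v} [AddCommGroup V] [Module K V] [Module (Aq q) V] [IsScalarTower K (Aq q) V]

theorem Tet.action_zero_one_eq (S : Module (Tet q) V) [IsScalarTower K (Tet q) V]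
    (hx : ∀ w : V, Aq.gen q AqGen.x • w = Tet.gen q 0 1 • w) :
    Tet.action q V 0 1 = Algebra.lsmul K K V (Aq.gen q AqGen.x) :=
  LinearMap.ext fun v => (Tet.action_apply _ v).trans (hx v).symm

theorem Tet.action_two_three_eq (S : Module (Tet q) V) [IsScalarTower K (Tet q) V]
    (hy : ∀ w : V, Aq.gen q AqGen.y • w = Tet.gen q 2 3 • w) :
    Tet.action q V 2 3 = Algebra.lsmul K K V (Aq.gen q AqGen.y) :=
  LinearMap.ext fun v => (Tet.action_apply _ v).trans (hy v).symm

theorem Aq.smul_eq_toTet_smul (S : Module (Tet q) V) [IsScalarTower K (Tet q) V]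
    (hx : ∀ w : V, Aq.gen q AqGen.x • w = Tet.gen q 0 1 • w)
    (hy : ∀ w : V, Aq.gen q AqGen.y • w = Tet.gen q 2 3 • w) (a : Aq q) :
    ∀ w : V, a • w = Aq.toTet q a • w := by
  induction a using Aq.induction with
  | halg k => intro w; rw [AlgHom.commutes, algebraMap_smul, algebraMap_smul]
  | hx => intro w; rw [Aq.toTet_x, hx]
  | hy => intro w; rw [Aq.toTet_y, hy]
  | hmul a b ha hb => intro w; rw [mul_smul, map_mul, mul_smul, hb, ha]
  | hadd a b ha hb => intro w; rw [add_smul, map_add, add_smul, hb, ha]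

theorem Aq.exists_tetModule [IsAlgClosed K] [FiniteDimensional K V] (hq : IsGeneric q)
    [IsSimpleModule (Aq q) V] (ht : Aq.HasType q V 1 1) :
    ∃ S : Module (Tet q) V, IsScalarTower K (Tet q) V ∧
      (∀ w : V, Aq.gen q AqGen.x • w = Tet.gen q 0 1 • w) ∧
      (∀ w : V, Aq.gen q AqGen.y • w = Tet.gen q 2 3 • w) := by
  obtain ⟨d, hS⟩ := Aq.exists_isSerrePair (V := V) hq ht
  obtain ⟨E, hE, hX, hY⟩ := hS.exists_tetRelations hq Aq.jointlyIrreducible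
  obtain ⟨φ, hφ⟩ := hE.exists_algHom hq
  refine ⟨Module.compHom V φ.toRingHom, ?_⟩
  let := Module.compHom V φ.toRingHom
  have hsmul : ∀ (a : Tet q) (v : V), a • v = φ a v := fun a v => rfl
  refine ⟨⟨fun k a v => ?_⟩, fun w => ?_, fun w => ?_⟩
  · rw [hsmul, hsmul, map_smul, LinearMap.smul_apply]
  · rw [hsmul, hφ, hX]
    rfl
  · rw [hsmul, hφ, hY]
    rfl

theorem Aq.tetModule_unique [IsAlgClosed K] [FiniteDimensional K V] (hq : IsGeneric q)
    [IsSimpleModule (Aq q) V] (ht : Aq.HasType q V 1 1) (S S' : Module (Tet q) V)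
    (hS : (letI := S; IsScalarTower K (Tet q) V) ∧
      (letI := S; ∀ w : V, Aq.gen q AqGen.x • w = Tet.gen q 0 1 • w) ∧
      (letI := S; ∀ w : V, Aq.gen q AqGen.y • w = Tet.gen q 2 3 • w))
    (hS' : (letI := S'; IsScalarTower K (Tet q) V) ∧
      (letI := S'; ∀ w : V, Aq.gen q AqGen.x • w = Tet.gen q 0 1 • w) ∧
      (letI := S'; ∀ w : V, Aq.gen q AqGen.y • w = Tet.gen q 2 3 • w)) : S' = S := by
  obtain ⟨t, hx, hy⟩ := hS
  obtain ⟨t', hx', hy'⟩ := hS'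
  obtain ⟨d, hP⟩ := Aq.exists_isSerrePair (V := V) hq ht
  have hirr := Aq.jointlyIrreducible (q := q) (V := V)
  have e01 := @Tet.action_zero_one_eq K _ q V _ _ _ _ S t hx
  have e23 := @Tet.action_two_three_eq K _ q V _ _ _ _ S t hy
  have e01' := @Tet.action_zero_one_eq K _ q V _ _ _ _ S' t' hx'
  have e23' := @Tet.action_two_three_eq K _ q V _ _ _ _ S' t' hy'
  have hu := (@Tet.tetRelations_action K _ q V _ _ S t hq).unique hq
    (@Tet.tetRelations_action K _ q V _ _ S' t' hq) (d := d) (e01'.trans e01.symm)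
    (e23'.trans e23.symm) (e01 ▸ hP.diag_left) (e23 ▸ hP.diag_right) (e01 ▸ e23 ▸ hirr)
  refine Module.ext' _ _ fun a => ?_
  induction a using Tet.induction with
  | halg k =>
    intro v
    have h1 := letI := S; algebraMap_smul (Tet q) k v
    have h2 := letI := S'; algebraMap_smul (Tet q) k v
    exact h2.trans h1.symm
  | hgen i j h =>
    intro v
    have := congrArg (fun f : Module.End K V => f v) (hu i j h)
    exact ((@Tet.action_apply K _ q V _ _ S' t' i j h v).symm.trans this).trans
      (@Tet.action_apply K _ q V _ _ S t i j h v)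
  | hmul a b ha hb =>
    intro v
    exact (S'.mul_smul a b v).trans ((ha _).trans
      ((congrArg (fun w => S.smul a w) (hb v)).trans (S.mul_smul a b v).symm))
  | hadd a b ha hb =>
    intro v
    exact (S'.add_smul a b v).trans ((congrArg₂ (· + ·) (ha v) (hb v)).trans
      (S.add_smul a b v).symm)

theorem Aq.tetModule_isSimple_hasType [IsAlgClosed K] [FiniteDimensional K V] (hq : IsGeneric q)
    [IsSimpleModule (Aq q) V] (ht : Aq.HasType q V 1 1) (S : Module (Tet q) V)
    [IsScalarTower K (Tet q) V] (hx : ∀ w : V, Aq.gen q AqGen.x • w = Tet.gen q 0 1 • w)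
    (hy : ∀ w : V, Aq.gen q AqGen.y • w = Tet.gen q 2 3 • w) :
    IsSimpleModule (Tet q) V ∧ Tet.HasType q V 1 := by
  obtain ⟨d, hP⟩ := Aq.exists_isSerrePair (V := V) hq ht
  have hirr := Aq.jointlyIrreducible (q := q) (V := V)
  rw [← Tet.action_zero_one_eq S hx, ← Tet.action_two_three_eq S hy] at hP hirr
  have : Nontrivial V := IsSimpleModule.nontrivial (Aq q) V
  constructor
  · refine (isSimpleModule_iff (Tet q) V).2 { eq_bot_or_eq_top := fun W => ?_ }
    rcases hirr (W.restrictScalars K) (fun v hv => W.smul_mem _ hv) (fun v hv => W.smul_mem _ hv)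
      with hW | hW
    · exact .inl ((Submodule.restrictScalars_eq_bot_iff K (Tet q) V).1 hW)
    · exact .inr ((Submodule.restrictScalars_eq_top_iff K (Tet q) V).1 hW)
  · refine ⟨.inl rfl, d, fun i j h => ?_⟩
    rw [← Tet.action_eq h]
    have hR := Tet.tetRelations_action (V := V) hq
    refine ⟨hR.isSemisimple hq hP.diag_left hP.diag_right hirr i j h, Set.ext fun μ => ?_⟩
    simpa using hR.hasEigenvalue_iff hq hP.diag_left hP.diag_right hirr i j h μ

theorem Tet.HasType.restrict [IsAlgClosed K] [FiniteDimensional K V] (hq : IsGeneric q)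
    (S : Module (Tet q) V) [IsScalarTower K (Tet q) V] [IsSimpleModule (Tet q) V]
    (hx : ∀ w : V, Aq.gen q AqGen.x • w = Tet.gen q 0 1 • w)
    (hy : ∀ w : V, Aq.gen q AqGen.y • w = Tet.gen q 2 3 • w) (ht : Tet.HasType q V 1) :
    IsSimpleModule (Aq q) V ∧ Aq.NonNil q V ∧ Aq.HasType q V 1 1 := by
  obtain ⟨-, -, -, hirr⟩ := ht.exists_diagonal hq
  obtain ⟨d, hd⟩ := ht.spectrum
  have h01 := (hd 0 1 (by decide)).2
  have h23 := (hd 2 3 (by decide)).2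
  rw [Tet.action_zero_one_eq S hx] at hirr h01
  rw [Tet.action_two_three_eq S hy] at hirr h23
  have : Nontrivial V := IsSimpleModule.nontrivial (Tet q) V
  have hnil : ∀ f : Module.End K V, (∀ μ, f.HasEigenvalue μ ↔
      ∃ n : ℕ, n ≤ d ∧ μ = q ^ ((d : ℤ) - 2 * (n : ℤ))) → ¬ IsNilpotent f := fun f hf hn =>
    zpow_ne_zero _ hq.ne_zero
      (((hf _).2 ⟨0, Nat.zero_le d, rfl⟩).isNilpotent_of_isNilpotent hn).eq_zero
  refine ⟨Aq.isSimpleModule hirr, ?_, one_ne_zero, one_ne_zero, d, Set.ext fun μ => ?_,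
    Set.ext fun μ => ?_⟩
  · rintro (_ | _)
    · exact hnil _ h01
    · exact hnil _ h23
  · simpa using h01 μ
  · simpa using h23 μ

end Both

end ModuleTheory
/-! ### Isomorphism classes -/

section Classes

variable {K : Type u} [Field K] {q : K}

theorem Tet.restrictClass_mk (M : ModuleCat.{v} (Tet q)) :
    Tet.restrictClass q (ModIsoClass.mk M) =
      ModIsoClass.mk ((ModuleCat.restrictScalars.{v} (Aq.toTet q).toRingHom).obj M) := rfl

theorem ModIsoClass.mk_eq_iff {R : Type u} [Ring R] {M N : ModuleCat.{v} R} :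
    ModIsoClass.mk M = ModIsoClass.mk N ↔ Nonempty (M ≃ₗ[R] N) := by
  refine ⟨fun h => ?_, fun ⟨e⟩ => Quotient.sound ⟨e.toModuleIso⟩⟩
  obtain ⟨e⟩ := Quotient.exact h
  exact ⟨e.toLinearEquiv⟩

/-- In the module category the `K`-structure is derived from the ring in use, so two equal but
differently built structures occur and the type is transported between them. -/
theorem Tet.HasType.of_module_eq {V : Type v} [AddCommGroup V] [Module (Tet q) V]
    {m₁ m₂ : Module K V} (h : m₁ = m₂) {_ : letI := m₁; IsScalarTower K (Tet q) V}
    {_ : letI := m₂; IsScalarTower K (Tet q) V} {ε : K}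
    (ht : letI := m₁; Tet.HasType q V ε) : letI := m₂; Tet.HasType q V ε := by
  subst h
  exact ht

theorem Tet.restrictClass_mapsTo [IsAlgClosed K] (hq : IsGeneric q) :
    Set.MapsTo (Tet.restrictClass.{u, v} q) (Tet.typeOneClasses.{u, v} q)
      (Aq.typeOneClasses.{u, v} q) := by
  rintro _ ⟨M, rfl, hfin, hs, ht⟩
  rw [Tet.restrictClass_mk]
  refine ⟨_, rfl, ?_⟩
  set N := (ModuleCat.restrictScalars.{v} (Aq.toTet q).toRingHom).obj M with hN
  let S : Module (Tet q) N := inferInstanceAs (Module (Tet q) M)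
  have hsmul : ∀ (a : Aq q) (w : N), a • w = Aq.toTet q a • w := fun a w => rfl
  -- One `K`-structure comes through `A_q` and the other through `⊠_q`; they agree because
  -- `Aq.toTet` fixes scalars.
  have hk : (ModuleCat.moduleOfAlgebraModule N : Module K N) =
      (ModuleCat.moduleOfAlgebraModule M : Module K M) := by
    refine Module.ext' _ _ fun k w => ?_
    have h : Aq.toTet q (algebraMap K (Aq q) k) • w = algebraMap K (Tet q) k • w := by
      rw [AlgHom.commutes]
    exact h
  have tower : IsScalarTower K (Tet q) N := by
    rw [hk]
    exact ModuleCat.isScalarTower_of_algebra_moduleCat M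
  have hfin' : Module.Finite K N := by
    rw [hk]
    exact hfin
  have hs' : IsSimpleModule (Tet q) N := hs
  have ht' : Tet.HasType q N 1 := Tet.HasType.of_module_eq hk.symm ht
  exact ⟨hfin', ht'.restrict hq S (fun w => by rw [hsmul, Aq.toTet_x])
    fun w => by rw [hsmul, Aq.toTet_y]⟩

/-- An `A_q`-isomorphism is `K`-linear and commutes with `x₀₁` and `x₂₃`, so `Tet.map_smul_of_gen`
makes it `⊠_q`-linear. -/
theorem Tet.restrictClass_injOn [IsAlgClosed K] (hq : IsGeneric q) :
    Set.InjOn (Tet.restrictClass.{u, v} q) (Tet.typeOneClasses.{u, v} q) := by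
  rintro _ ⟨M, rfl, hfin, hs, ht⟩ _ ⟨M', rfl, -, -, -⟩ h
  rw [Tet.restrictClass_mk, Tet.restrictClass_mk, ModIsoClass.mk_eq_iff] at h
  obtain ⟨e⟩ := h
  let e₀ : M ≃+ M' := e.toAddEquiv
  have he : ∀ (a : Aq q) (m : M), e₀ (Aq.toTet q a • m) = Aq.toTet q a • e₀ m :=
    fun a m => e.map_smul a m
  let e₁ : M ≃ₗ[K] M' :=
    { e₀ with
      map_smul' := fun k m => by
        have := he (algebraMap K (Aq q) k) m
        rw [AlgHom.commutes, algebraMap_smul, algebraMap_smul] at this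
        exact this }
  have hlin := Tet.map_smul_of_gen hq ht e₁
    (fun v => by
      rw [Tet.action_apply (by decide), Tet.action_apply (by decide), ← Aq.toTet_x]
      exact he _ v)
    (fun v => by
      rw [Tet.action_apply (by decide), Tet.action_apply (by decide), ← Aq.toTet_y]
      exact he _ v)
  exact ModIsoClass.mk_eq_iff.2 ⟨{ e₀ with map_smul' := hlin }⟩

theorem Tet.restrictClass_surjOn [IsAlgClosed K] (hq : IsGeneric q) :
    Set.SurjOn (Tet.restrictClass.{u, v} q) (Tet.typeOneClasses.{u, v} q)
      (Aq.typeOneClasses.{u, v} q) := by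
  rintro _ ⟨N, rfl, hfin, hs, -, ht⟩
  obtain ⟨S, tower, hx, hy⟩ := Aq.exists_tetModule (V := N) hq ht
  obtain ⟨hs', ht'⟩ := Aq.tetModule_isSimple_hasType hq ht S hx hy
  have hk : (ModuleCat.moduleOfAlgebraModule (ModuleCat.of (Tet q) N) : Module K N) =
      ModuleCat.moduleOfAlgebraModule N :=
    module_eq_of_isScalarTower (A := Tet q) _ _
      (ModuleCat.isScalarTower_of_algebra_moduleCat (ModuleCat.of (Tet q) N)) tower
  refine ⟨ModIsoClass.mk (ModuleCat.of (Tet q) N), ⟨_, rfl, ?_, hs', ?_⟩, ?_⟩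
  · rw [hk]
    exact hfin
  · exact Tet.HasType.of_module_eq hk.symm ht'
  · rw [Tet.restrictClass_mk, ModIsoClass.mk_eq_iff]
    exact ⟨{ AddEquiv.refl N with
      map_smul' := fun a m => (Aq.smul_eq_toTet_smul S hx hy a m).symm }⟩

end Classes

theorem theorem10p3 {K : Type u} [Field K] [IsAlgClosed K] (q : K) (hq0 : q ≠ 0)
    (hq : ∀ n : ℕ, 0 < n → q ^ n ≠ 1) :
    (∀ (V : Type v) [AddCommGroup V] [Module K V] [Module (Aq q) V] [IsScalarTower K (Aq q) V],
      Module.Finite K V → IsSimpleModule (Aq q) V → Aq.NonNil q V → Aq.HasType q V 1 1 →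
        (∃! S : Module (Tet q) V, IsScalarTower K (Tet q) V ∧
          (∀ w : V, Aq.gen q AqGen.x • w = Tet.gen q 0 1 • w) ∧
          (∀ w : V, Aq.gen q AqGen.y • w = Tet.gen q 2 3 • w)) ∧
        (∀ (S : Module (Tet q) V) (_ : IsScalarTower K (Tet q) V),
          (∀ w : V, Aq.gen q AqGen.x • w = Tet.gen q 0 1 • w) →
          (∀ w : V, Aq.gen q AqGen.y • w = Tet.gen q 2 3 • w) →
          IsSimpleModule (Tet q) V ∧ Tet.HasType q V 1)) ∧
    Set.BijOn (Tet.restrictClass.{u, v} q) (Tet.typeOneClasses.{u, v} q)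
      (Aq.typeOneClasses.{u, v} q) := by
  have hq' : IsGeneric q := ⟨hq0, hq⟩
  refine ⟨fun V _ _ _ _ hfin hs _ ht => ⟨?_, fun S _ hx hy =>
    Aq.tetModule_isSimple_hasType hq' ht S hx hy⟩, Tet.restrictClass_mapsTo hq',
    Tet.restrictClass_injOn hq', Tet.restrictClass_surjOn hq'⟩
  obtain ⟨S, hS⟩ := Aq.exists_tetModule (V := V) hq' ht
  exact ⟨S, hS, fun S' hS' => Aq.tetModule_unique hq' ht S S' hS hS'⟩
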